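/- Let $X=(X_n)_{n\ge 0}$ be a homogeneous Markov process with Markov kernel $\Pi$ on a measurable state space $E$, started in $x$ under $\mathbb P_x$ ($x\in E$), and let $0<\alpha<1$. Let $\xi^{(1)}=(\xi^{(1)}_n)_{n\ge0}$ and $\xi^{(2)}=(\xi^{(2)}_n)_{n\ge0}$ be sequences of i.i.d. random variables, uniform on $(0,1)$, such that $X,\xi^{(1)},\xi^{(2)}$ are independent. Let $\tilde X$ be the process $X$ killed at each time $n\ge 1$ with probability $1-\alpha$, independently of everything else; after killing it stays in a cemetery state, where all functions take the value $0$. Let $f,g,h:E\to\mathbb R$ be measurable with $\sup_n|f(\tilde X_n)|,\ \sup_n|g(\tilde X_n)|,\ \sup_n|h(\tilde X_n)|\in L^1(\mathbb P_x)$ for every $x\in E$. The admissible stopping times of player $i\in\{1,2\}$ are the stopping times (with values in $\mathbb N_0\cup\{\infty\}$) of the filtration $\sigma(X_0,\dots,X_n,\xi^{(i)}_0,\dots,\xi^{(i)}_n)$, $n\ge0$. In the zero-sum Dynkin game player $1$ maximizes and player $2$ minimizes $$J(x;\tau_1,\tau_2)=\mathbb E_x\big[\alpha^{\tau_1}f(X_{\tau_1})\mathbb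 I_{\{\tau_1<\tau_2\}}+\alpha^{\tau_2}g(X_{\tau_2})\mathbb I_{\{\tau_2<\tau_1\}}+\alpha^{\tau_1}h(X_{\tau_1})\mathbb I_{\{\tau_1=\tau_2<\infty\}}\big]$$ over their admissible stopping times. A measurable $p:E\to[0,1]$ determines, for player $i$, the Markovian randomized stopping time $\tau^{p}=\inf\{n\ge0: p(X_n)\ge\xi^{(i)}_n\}$. A pair $(p^{(1)},p^{(2)})$ of such functions is a global Markovian randomized equilibrium if, for every $x\in E$, the pair $(\tau^{p^{(1)}},\tau^{p^{(2)}})$ is a Nash equilibrium: neither player can improve by deviating to another admissible stopping time. Its value is $V(x)=J(x;\tau^{p^{(1)}},\tau^{p^{(2)}})$, $x\in E$. Write $\Pi V(x)=\int V(y)\,\Pi(x,dy)$. Let $p^{(1)},p^{(2)}:E\to[0,1]$ and $V:E\to\mathbb R$ be measurable, and consider the following system, for all $x\in E$: \begin{align*} V(x)&=\max\{(1-p^{(2)}(x))\alpha\Pi V(x)+p^{(2)}(x)g(x),\ (1-p^{(2)}(x))f(x)+p^{(2)}(x)h(x)\},\\ V(x)&=\min\{(1-p^{(1)}(x))\alpha\Pi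 V(x)+p^{(1)}(x)f(x),\ (1-p^{(1)}(x))g(x)+p^{(1)}(x)h(x)\},\\ p^{(1)}(x)>0&\Rightarrow(1-p^{(2)}(x))\alpha\Pi V(x)+p^{(2)}(x)g(x)\le(1-p^{(2)}(x))f(x)+p^{(2)}(x)h(x),\\ p^{(1)}(x)<1&\Rightarrow(1-p^{(2)}(x))\alpha\Pi V(x)+p^{(2)}(x)g(x)\ge(1-p^{(2)}(x))f(x)+p^{(2)}(x)h(x),\\ p^{(2)}(x)>0&\Rightarrow(1-p^{(1)}(x))\alpha\Pi V(x)+p^{(1)}(x)f(x)\ge(1-p^{(1)}(x))g(x)+p^{(1)}(x)h(x),\\ p^{(2)}(x)<1&\Rightarrow(1-p^{(1)}(x))\alpha\Pi V(x)+p^{(1)}(x)f(x)\le(1-p^{(1)}(x))g(x)+p^{(1)}(x)h(x). \end{align*} (A) If $(p^{(1)},p^{(2)})$ is a global Markovian randomized equilibrium with value $V$, then $V$ is $\Pi(x,\cdot)$-integrable for every $x\in E$, and $p^{(1)},p^{(2)},V$ satisfy the system. (B) If $p^{(1)},p^{(2)},V$ satisfy the system and $\sup_n|V(\tilde X_n)|\in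 L^1(\mathbb P_x)$ for every $x\in E$, then $(p^{(1)},p^{(2)})$ is a global Markovian randomized equilibrium with value $V$. -/

import Mathlib

open MeasureTheory ProbabilityTheory Set
open scoped ENNReal

namespace MarkovDynkin

variable {E Ω : Type*} [MeasurableSpace E] [MeasurableSpace Ω]

/-- A realization, on a measurable space `Ω` with probability measures `P x` (`x ∈ E`), of

* a homogeneous Markov process `X` with transition kernel `κ`, started in `x` under `P x`;
* the randomization devices `ξ i n` of the two players `i : Fin 2`, which are i.i.d. uniform on
  `(0, 1)` and independent of `X`;
* the i.i.d. killing coins `kill n` (`kill n ω = true`, of probability `1 - α`, means that the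
  process is killed at time `n ≥ 1`), which are independent of everything else. -/
structure Model (κ : Kernel E E) (α : ℝ) (Ω : Type*) [MeasurableSpace Ω] where
  P : E → Measure Ω
  isProb : ∀ x, IsProbabilityMeasure (P x)
  X : ℕ → Ω → E
  measurable_X : ∀ n, Measurable (X n)
  start : ∀ x, (P x).map (X 0) = Measure.dirac x
  markov : ∀ (x : E) (n : ℕ) (B : Set E), MeasurableSet B →
    (P x)⟦X (n + 1) ⁻¹' B | ⨆ k ≤ n, MeasurableSpace.comap (X k) inferInstance⟧
      =ᵐ[P x] fun ω => (κ (X n ω)).real B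
  ξ : Fin 2 → ℕ → Ω → ℝ
  measurable_ξ : ∀ i n, Measurable (ξ i n)
  law_ξ : ∀ x i n, (P x).map (ξ i n) = volume.restrict (Ioo (0 : ℝ) 1)
  iIndep_ξ : ∀ x, iIndepFun (fun q : Fin 2 × ℕ => ξ q.1 q.2) (P x)
  indep_X_ξ : ∀ x, IndepFun (fun ω n => X n ω) (fun ω (q : Fin 2 × ℕ) => ξ q.1 q.2 ω) (P x)
  kill : ℕ → Ω → Bool
  measurable_kill : ∀ n, Measurable (kill n)
  law_kill : ∀ x n, P x {ω | kill n ω = true} = ENNReal.ofReal (1 - α)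
  iIndep_kill : ∀ x, iIndepFun kill (P x)
  indep_kill : ∀ x, IndepFun
    (fun ω => ((fun n => X n ω), (fun q : Fin 2 × ℕ => ξ q.1 q.2 ω))) (fun ω n => kill n ω) (P x)

/-- The payoff functions of the two players: `f i` if player `i` stops first, `g i` if the other
player stops first, `h i` if both stop simultaneously. -/
structure Payoffs (E : Type*) where
  f : Fin 2 → E → ℝ
  g : Fin 2 → E → ℝ
  h : Fin 2 → E → ℝ

/-- The zero-sum game: `f₁ = f, g₁ = g, h₁ = h, f₂ = -g, g₂ = -f, h₂ = -h`. -/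
def Payoffs.zeroSum (f g h : E → ℝ) : Payoffs E where
  f := ![f, -g]
  g := ![g, -f]
  h := ![h, -h]

namespace Model

variable {κ : Kernel E E} {α : ℝ} (M : Model κ α Ω)

/-- The filtration `σ(X₀, …, Xₙ, ξⁱ₀, …, ξⁱₙ)` of player `i`. -/
def filtration (i : Fin 2) : Filtration ℕ (inferInstance : MeasurableSpace Ω) where
  seq n := ⨆ k ≤ n, (MeasurableSpace.comap (M.X k) inferInstance ⊔
    MeasurableSpace.comap (M.ξ i k) inferInstance)
  mono' _ _ hmn := iSup₂_le fun k hk =>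
    le_iSup₂_of_le k (hk.trans hmn) le_rfl
  le' _ := iSup₂_le fun k _ =>
    sup_le (M.measurable_X k).comap_le (M.measurable_ξ i k).comap_le

/-- The admissible stopping times of player `i`. -/
def admissible (i : Fin 2) : Set (Ω → ℕ∞) :=
  {τ | IsStoppingTime (M.filtration i) τ}

/-- The Markovian randomized stopping time `inf {n : p (Xₙ) ≥ ξⁱₙ}` (with `inf ∅ = ∞`). -/
noncomputable def markovTime (i : Fin 2) (p : E → ℝ) (ω : Ω) : ℕ∞ :=
  ⨅ (n : ℕ) (_ : p (M.X n ω) ≥ M.ξ i n ω), (n : ℕ∞)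

/-- The discounted reward that player `i` obtains along `ω` when the players use the stopping times
`τ 0` and `τ 1`. The other player is `1 - i`. -/
noncomputable def reward (G : Payoffs E) (i : Fin 2) (τ : Fin 2 → Ω → ℕ∞) (ω : Ω) : ℝ :=
  let s := τ i ω
  let t := τ (1 - i) ω
  if s < t then α ^ s.toNat * G.f i (M.X s.toNat ω)
  else if t < s then α ^ t.toNat * G.g i (M.X t.toNat ω)
  else if s < ⊤ then α ^ s.toNat * G.h i (M.X s.toNat ω)
  else 0

/-- The expected reward `Jᵢ(x; τ₁, τ₂)`. -/
noncomputable def J (G : Payoffs E) (i : Fin 2) (x : E) (τ : Fin 2 → Ω → ℕ∞) : ℝ :=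
  ∫ ω, M.reward G i τ ω ∂(M.P x)

/-- `τ` is a Nash equilibrium for `x`: both stopping times are admissible and each attains the
supremum of that player's expected reward over the admissible stopping times, the other one being
fixed. -/
def IsNash (G : Payoffs E) (x : E) (τ : Fin 2 → Ω → ℕ∞) : Prop :=
  (∀ i, τ i ∈ M.admissible i) ∧
    ∀ i, IsLUB ((fun σ => M.J G i x (Function.update τ i σ)) '' M.admissible i) (M.J G i x τ)

/-- The pair of stopping times that corresponds to a pair `p` of Markovian stopping strategies. -/
noncomputable def markovPair (p : Fin 2 → E → ℝ) (i : Fin 2) : Ω → ℕ∞ :=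
  M.markovTime i (p i)

/-- `p` is a global Markovian randomized equilibrium. -/
def IsGlobalEquilibrium (G : Payoffs E) (p : Fin 2 → E → ℝ) : Prop :=
  ∀ x, M.IsNash G x (M.markovPair p)

open Classical in
/-- The killed process; `none` is the cemetery state. -/
noncomputable def killed (n : ℕ) (ω : Ω) : Option E :=
  if ∃ k, 0 < k ∧ k ≤ n ∧ M.kill k ω = true then none else some (M.X n ω)

/-- `supₙ |u(X̃ₙ)| ∈ L¹(P x)` for all `x`, where `u` is extended by `0` to the cemetery state. The
supremum is taken in `[0, ∞]`. -/
def SupIntegrable (u : E → ℝ) : Prop :=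
  ∀ x, ∫⁻ ω, ⨆ n, ‖(M.killed n ω).elim 0 u‖ₑ ∂(M.P x) < ∞

/-- The standing integrability assumption on the payoff functions. -/
def PayoffsIntegrable (G : Payoffs E) : Prop :=
  ∀ i, M.SupIntegrable (G.f i) ∧ M.SupIntegrable (G.g i) ∧ M.SupIntegrable (G.h i)

/-- `V` is the value of the equilibrium `p` in the zero-sum game: the expected payment from the
minimizer to the maximizer, which is the expected reward of the maximizer. -/
def HasValue (f g h : E → ℝ) (p : Fin 2 → E → ℝ) (V : E → ℝ) : Prop :=
  ∀ x, V x = M.J (Payoffs.zeroSum f g h) 0 x (M.markovPair p)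

end Model

/-- The system of Wald-Bellman type equations for the zero-sum game. -/
structure ZeroSumSystem (κ : Kernel E E) (α : ℝ) (f g h p₁ p₂ V : E → ℝ) : Prop where
  value_max : ∀ x, V x = max ((1 - p₂ x) * (α * ∫ y, V y ∂(κ x)) + p₂ x * g x)
    ((1 - p₂ x) * f x + p₂ x * h x)
  value_min : ∀ x, V x = min ((1 - p₁ x) * (α * ∫ y, V y ∂(κ x)) + p₁ x * f x)
    ((1 - p₁ x) * g x + p₁ x * h x)
  max_stop : ∀ x, p₁ x > 0 →
    (1 - p₂ x) * (α * ∫ y, V y ∂(κ x)) + p₂ x * g x ≤ (1 - p₂ x) * f x + p₂ x * h x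
  max_cont : ∀ x, p₁ x < 1 →
    (1 - p₂ x) * (α * ∫ y, V y ∂(κ x)) + p₂ x * g x ≥ (1 - p₂ x) * f x + p₂ x * h x
  min_stop : ∀ x, p₂ x > 0 →
    (1 - p₁ x) * (α * ∫ y, V y ∂(κ x)) + p₁ x * f x ≥ (1 - p₁ x) * g x + p₁ x * h x
  min_cont : ∀ x, p₂ x < 1 →
    (1 - p₁ x) * (α * ∫ y, V y ∂(κ x)) + p₁ x * f x ≤ (1 - p₁ x) * g x + p₁ x * h x

end MarkovDynkin

/-! Fix an opponent who stops in state `y` with probability `q y`. Stopping is then worth `(1 - q) f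
+ q h`, and waiting one round is worth `(1 - q) α ΠV + q g`. Two facts reduce the game to these
expressions. The opponent's coin at time `n` is independent of `X` and of everything the player
observes, so it can be integrated out (`lawOn_lt_seqTime`, `lawOn_seqTime_eq`). And `X` moves by `κ`
even when all coins are known (`map_next`).

For (B), the expected reward collected when the game ends at time `n` equals the decrease of `αⁿ ∫
V` over the law of `Xₙ` on the event that nobody has stopped before `n`, minus the integrated
deficits of stopping and of waiting with respect to `V` (`setIntegral_reward_eq_sub`). Summation
over `n` telescopes, and the remainder vanishes because the killed process eventually sits in the
cemetery. Nonnegative deficits give `J_le` against every admissible time. Under the conditions on `p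
> 0` and `p < 1` the deficits carry no weight, which gives `J_eq`.

For (A), no integrability of `V` is given, so `J` is expanded as an absolutely convergent series of
round payoffs against discounted laws, which are iterates of a weighted kernel (`J_eq_sum_add`).
This yields the one-step formula `J_firstThen`. Deviating at time `0` only, to certain stopping or
certain waiting, shows that `V` dominates both options; `V` is also their mixture with weights `p`
and `1 - p`, so each option with positive weight equals `V`.

Both arguments are made for one maximizing player with general payoffs; the minimizer is the
maximizer of the negated game. -/

/-- A π-λ argument: the sets `s ∩ t` form a π-system generating the join. It serves to extend
identities from process events and coin events separately to their joint σ-algebra. -/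
theorem MeasureTheory.measure_eq_of_inter_eq {Ω : Type*} {m₁ m₂ m₀ : MeasurableSpace Ω}
    (h₁ : m₁ ≤ m₀) (h₂ : m₂ ≤ m₀) {μ ν : Measure Ω} [IsFiniteMeasure μ]
    (h : ∀ s t, MeasurableSet[m₁] s → MeasurableSet[m₂] t → μ (s ∩ t) = ν (s ∩ t))
    {A : Set Ω} (hA : MeasurableSet[m₁ ⊔ m₂] A) : μ A = ν A := by
  have huniv : μ univ = ν univ := by simpa using h univ univ .univ .univ
  have : IsFiniteMeasure ν := ⟨huniv ▸ measure_lt_top μ univ⟩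
  have hgen : m₁ ⊔ m₂ = MeasurableSpace.generateFrom
      (image2 (· ∩ ·) {s | MeasurableSet[m₁] s} {t | MeasurableSet[m₂] t}) := by
    refine le_antisymm (sup_le (fun s hs => ?_) (fun t ht => ?_))
      (MeasurableSpace.generateFrom_le ?_)
    · exact MeasurableSpace.measurableSet_generateFrom ⟨s, hs, univ, .univ, inter_univ s⟩
    · exact MeasurableSpace.measurableSet_generateFrom ⟨univ, .univ, t, ht, univ_inter t⟩
    · rintro _ ⟨s, hs, t, ht, rfl⟩
      exact MeasurableSet.inter (le_sup_left (a := m₁) (b := m₂) s hs)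
        (le_sup_right (a := m₁) (b := m₂) t ht)
  have hle : m₁ ⊔ m₂ ≤ m₀ := sup_le h₁ h₂
  induction A, hA using MeasurableSpace.induction_on_inter hgen with
  | h_inter =>
    rintro _ ⟨s, hs, t, ht, rfl⟩ _ ⟨s', hs', t', ht', rfl⟩ -
    exact ⟨s ∩ s', MeasurableSet.inter hs hs', t ∩ t', MeasurableSet.inter ht ht',
      inter_inter_inter_comm s s' t t'⟩
  | empty => simp
  | basic u hu =>
    obtain ⟨s, hs, t, ht, rfl⟩ := hu
    exact h s t hs ht
  | compl t ht ih =>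
    rw [measure_compl (hle t ht) (measure_ne_top μ t), measure_compl (hle t ht)
      (measure_ne_top ν t), ih, huniv]
  | iUnion f hd hf ih =>
    rw [measure_iUnion hd fun i => hle _ (hf i), measure_iUnion hd fun i => hle _ (hf i)]
    simp_rw [ih]

/-! ### Markov property given the coins, and independence of a single coin -/

namespace MarkovDynkin.Model

variable {E Ω : Type*} [MeasurableSpace E] [MeasurableSpace Ω] {κ : Kernel E E} {α : ℝ}
  (M : Model κ α Ω)

/-- The information given by `X₀, …, Xₙ` and by all randomization devices. -/
@[reducible] def pastAndNoise (n : ℕ) : MeasurableSpace Ω :=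
  (⨆ k ≤ n, MeasurableSpace.comap (M.X k) inferInstance) ⊔
    ⨆ q : Fin 2 × ℕ, MeasurableSpace.comap (M.ξ q.1 q.2) inferInstance

/-- The information given by the process `X` and by all randomization devices except `ξ j n`. -/
@[reducible] def allExcept (j : Fin 2) (n : ℕ) : MeasurableSpace Ω :=
  (⨆ k, MeasurableSpace.comap (M.X k) inferInstance) ⊔
    ⨆ q ∈ ({(j, n)}ᶜ : Set (Fin 2 × ℕ)), MeasurableSpace.comap (M.ξ q.1 q.2) inferInstance

theorem iSup_comap_X_le :
    (⨆ k, MeasurableSpace.comap (M.X k) inferInstance) ≤ ‹MeasurableSpace Ω› :=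
  iSup_le fun k => (M.measurable_X k).comap_le

theorem iSup_comap_ξ_le :
    (⨆ q : Fin 2 × ℕ, MeasurableSpace.comap (M.ξ q.1 q.2) inferInstance) ≤ ‹MeasurableSpace Ω› :=
  iSup_le fun q => (M.measurable_ξ q.1 q.2).comap_le

theorem iSup_comap_past_le (n : ℕ) :
    (⨆ k ≤ n, MeasurableSpace.comap (M.X k) inferInstance) ≤
      ⨆ k, MeasurableSpace.comap (M.X k) inferInstance :=
  iSup₂_le fun k _ => le_iSup (fun k => MeasurableSpace.comap (M.X k) inferInstance) k

theorem pastAndNoise_le (n : ℕ) : M.pastAndNoise n ≤ ‹MeasurableSpace Ω› :=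
  sup_le ((M.iSup_comap_past_le n).trans M.iSup_comap_X_le) M.iSup_comap_ξ_le

theorem allExcept_le (j : Fin 2) (n : ℕ) : M.allExcept j n ≤ ‹MeasurableSpace Ω› :=
  sup_le M.iSup_comap_X_le (iSup₂_le fun q _ => (M.measurable_ξ q.1 q.2).comap_le)

theorem indep_process_noise (x : E) :
    Indep (⨆ k, MeasurableSpace.comap (M.X k) inferInstance)
      (⨆ q : Fin 2 × ℕ, MeasurableSpace.comap (M.ξ q.1 q.2) inferInstance) (M.P x) := by
  have h := M.indep_X_ξ x
  rw [IndepFun_iff_Indep] at h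
  convert h using 1
  · simp [MeasurableSpace.pi, MeasurableSpace.comap_iSup, MeasurableSpace.comap_comp,
      Function.comp_def]
  · simp [MeasurableSpace.pi, MeasurableSpace.comap_iSup, MeasurableSpace.comap_comp,
      Function.comp_def]

/-- The Markov property of the model conditions on the past of `X` only. Adding all coins is
harmless because they are independent of the whole process, `X (n + 1)` included. -/
theorem measure_inter_next [IsMarkovKernel κ] (x : E) (n : ℕ) {A : Set Ω}
    (hA : MeasurableSet[M.pastAndNoise n] A) {B : Set E} (hB : MeasurableSet B) :
    M.P x (A ∩ M.X (n + 1) ⁻¹' B) = ∫⁻ ω in A, κ (M.X n ω) B ∂(M.P x) := by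
  have := M.isProb x
  have hpast := (M.iSup_comap_past_le n).trans M.iSup_comap_X_le
  have hXB : MeasurableSet (M.X (n + 1) ⁻¹' B) := M.measurable_X _ hB
  have hdens : Measurable[⨆ k, MeasurableSpace.comap (M.X k) inferInstance]
      fun ω => κ (M.X n ω) B :=
    (κ.measurable_coe hB).comp ((comap_measurable (M.X n)).mono
      (le_iSup (fun k => MeasurableSpace.comap (M.X k) inferInstance) n) le_rfl)
  have hmarkov : ∀ s, MeasurableSet[⨆ k ≤ n, MeasurableSpace.comap (M.X k) inferInstance] s →
      M.P x (s ∩ M.X (n + 1) ⁻¹' B) = ∫⁻ ω in s, κ (M.X n ω) B ∂(M.P x) := by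
    intro s hs
    have h1 : ∫ ω in s, (κ (M.X n ω)).real B ∂(M.P x)
        = ∫ ω in s, (M.X (n + 1) ⁻¹' B).indicator (fun _ => (1 : ℝ)) ω ∂(M.P x) := by
      rw [← setIntegral_condExp hpast ((integrable_const (1 : ℝ)).indicator hXB) hs]
      exact setIntegral_congr_ae (hpast s hs)
        ((M.markov x n B hB).mono fun ω hω _ => hω.symm)
    have hm : Measurable fun ω => κ (M.X n ω) B := hdens.mono M.iSup_comap_X_le le_rfl
    have h2 : (fun ω => (M.X (n + 1) ⁻¹' B).indicator (fun _ => (1 : ℝ)) ω)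
      = (M.X (n + 1) ⁻¹' B).indicator 1 := rfl
    rw [h2, integral_indicator_one hXB] at h1
    simp only [Measure.real] at h1
    rw [integral_toReal hm.aemeasurable (ae_of_all _ fun ω => measure_lt_top _ _)] at h1
    rw [Measure.restrict_apply hXB] at h1
    rw [inter_comm, ← ENNReal.toReal_eq_toReal_iff' (measure_ne_top _ _), ← h1]
    refine ((lintegral_mono fun ω => prob_le_one).trans_lt (?_ : ∫⁻ ω in s, 1 ∂(M.P x) < ∞)).ne
    simp
  have key := measure_eq_of_inter_eq (μ := (M.P x).restrict (M.X (n + 1) ⁻¹' B))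
    (ν := (M.P x).withDensity fun ω => κ (M.X n ω) B) hpast M.iSup_comap_ξ_le ?_ hA
  · rw [Measure.restrict_apply (M.pastAndNoise_le n _ hA),
      withDensity_apply _ (M.pastAndNoise_le n _ hA)] at key
    exact key
  · intro s t hs ht
    have hs0 := hpast s hs
    have ht0 := M.iSup_comap_ξ_le t ht
    have hsX := M.iSup_comap_past_le n s hs
    have hind := M.indep_process_noise x
    -- The noise event `t` factors out on both sides: by independence on the left, and on the right
    -- because the integrand restricted to `s` depends on the process alone.
    rw [Measure.restrict_apply (hs0.inter ht0), withDensity_apply _ (hs0.inter ht0),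
      inter_right_comm, (Indep_iff _ _ _).1 hind _ _ (hsX.inter
        (le_iSup (fun k => MeasurableSpace.comap (M.X k) inferInstance) (n + 1) _ ⟨B, hB, rfl⟩)) ht,
      hmarkov s hs, ← lintegral_indicator hs0, ← lintegral_indicator (hs0.inter ht0),
      ← lintegral_indicator_one ht0,
      ← lintegral_mul_eq_lintegral_mul_lintegral_of_independent_measurableSpace
        M.iSup_comap_X_le M.iSup_comap_ξ_le hind (hdens.indicator hsX)
        (Measurable.indicator (f := 1) (@measurable_const _ _ _ (_) 1) ht)]
    refine lintegral_congr fun ω => ?_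
    by_cases h1 : ω ∈ s <;> by_cases h2 : ω ∈ t <;> simp [h1, h2]

theorem map_next [IsMarkovKernel κ] (x : E) (n : ℕ) {A : Set Ω}
    (hA : MeasurableSet[M.pastAndNoise n] A) :
    ((M.P x).restrict A).map (M.X (n + 1)) = κ ∘ₘ ((M.P x).restrict A).map (M.X n) := by
  ext B hB
  rw [Measure.map_apply (M.measurable_X _) hB, Measure.restrict_apply (M.measurable_X _ hB),
    inter_comm, M.measure_inter_next x n hA hB, Measure.bind_apply hB κ.aemeasurable,
    lintegral_map (κ.measurable_coe hB) (M.measurable_X n)]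

/-- Independence is used twice: the process is split off from the coins, then `ξ j n` from the
remaining coins. -/
theorem indep_coin (x : E) (j : Fin 2) (n : ℕ) :
    Indep (M.allExcept j n) (MeasurableSpace.comap (M.ξ j n) inferInstance) (M.P x) := by
  have := M.isProb x
  rw [Indep_iff]
  intro A C hA hC
  have hC0 := (M.measurable_ξ j n).comap_le C hC
  have hcoins := indep_iSup_of_disjoint (m := fun q : Fin 2 × ℕ =>
    MeasurableSpace.comap (M.ξ q.1 q.2) inferInstance) (fun q => (M.measurable_ξ q.1 q.2).comap_le)
    (M.iIndep_ξ x).iIndep (S := {(j, n)}ᶜ) (T := {(j, n)}) disjoint_compl_left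
  have hind := M.indep_process_noise x
  rw [Indep_iff] at hcoins hind
  have hle : (⨆ q ∈ ({(j, n)}ᶜ : Set (Fin 2 × ℕ)), MeasurableSpace.comap (M.ξ q.1 q.2)
      inferInstance) ≤ ⨆ q : Fin 2 × ℕ, MeasurableSpace.comap (M.ξ q.1 q.2) inferInstance :=
    iSup₂_le fun q _ => le_iSup (fun q : Fin 2 × ℕ =>
        MeasurableSpace.comap (M.ξ q.1 q.2) inferInstance) q
  have hC' : MeasurableSet[⨆ q : Fin 2 × ℕ, MeasurableSpace.comap (M.ξ q.1 q.2) inferInstance] C :=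
    le_iSup (fun q : Fin 2 × ℕ => MeasurableSpace.comap (M.ξ q.1 q.2) inferInstance) (j, n) C hC
  have hCs : MeasurableSet[⨆ q ∈ ({(j, n)} : Set (Fin 2 × ℕ)),
      MeasurableSpace.comap (M.ξ q.1 q.2) inferInstance] C :=
    le_iSup₂ (f := fun (q : Fin 2 × ℕ) (_ : q ∈ ({(j, n)} : Set (Fin 2 × ℕ))) =>
        MeasurableSpace.comap (M.ξ q.1 q.2) inferInstance) (j, n) rfl C hC
  have key := measure_eq_of_inter_eq (μ := (M.P x).restrict C) (ν := M.P x C • M.P x)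
    M.iSup_comap_X_le (hle.trans M.iSup_comap_ξ_le) ?_ hA
  · rw [Measure.restrict_apply (M.allExcept_le j n _ hA)] at key
    rw [key, Measure.smul_apply, smul_eq_mul, mul_comm]
  · intro s t hs ht
    have hs0 := M.iSup_comap_X_le s hs
    have ht0 := M.iSup_comap_ξ_le t (hle t ht)
    rw [Measure.restrict_apply (hs0.inter ht0), inter_assoc,
      hind s _ hs (MeasurableSet.inter (hle t ht) hC'), hcoins t C ht hCs, Measure.smul_apply,
      smul_eq_mul, hind s t hs (hle t ht)]
    ring

theorem map_prod_coin (x : E) (j : Fin 2) (n : ℕ) {A : Set Ω}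
    (hA : MeasurableSet[M.allExcept j n] A) :
    ((M.P x).restrict A).map (fun ω => (M.X n ω, M.ξ j n ω)) =
      (((M.P x).restrict A).map (M.X n)).prod (volume.restrict (Ioo (0 : ℝ) 1)) := by
  have := M.isProb x
  have hA0 := M.allExcept_le j n _ hA
  have hX := M.measurable_X n
  have hξ := M.measurable_ξ j n
  symm
  refine Measure.prod_eq fun s t hs ht => ?_
  have hXs : MeasurableSet[M.allExcept j n] (M.X n ⁻¹' s) :=
    (le_sup_left : _ ≤ M.allExcept j n) _ (le_iSup (fun k => MeasurableSpace.comap (M.X k)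
      inferInstance) n _ ⟨s, hs, rfl⟩)
  rw [Measure.map_apply (hX.prodMk hξ) (hs.prod ht), Measure.map_apply hX hs,
    Measure.restrict_apply ((hX.prodMk hξ) (hs.prod ht)), Measure.restrict_apply (hX hs),
    ← M.law_ξ x j n, Measure.map_apply hξ ht,
    ← (Indep_iff _ _ _).1 (M.indep_coin x j n) _ _ (hXs.inter hA) ⟨t, ht, rfl⟩]
  congr 1
  ext ω
  simp only [mem_inter_iff, mem_preimage, mem_prod]
  tauto

/-- `S` is an acceptance region for the pair (state, coin). Since `A` does not see the coin, Fubini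
turns the acceptance event into a density: the length of the slice of `S`. -/
theorem map_coin (x : E) (j : Fin 2) (n : ℕ) {A : Set Ω}
    (hA : MeasurableSet[M.allExcept j n] A) {S : Set (E × ℝ)} (hS : MeasurableSet S) :
    ((M.P x).restrict (A ∩ {ω | (M.X n ω, M.ξ j n ω) ∈ S})).map (M.X n) =
      (((M.P x).restrict A).map (M.X n)).withDensity
        fun y => volume.restrict (Ioo (0 : ℝ) 1) (Prod.mk y ⁻¹' S) := by
  have := M.isProb x
  have hA0 := M.allExcept_le j n _ hA
  have hX := M.measurable_X n
  have hξ := M.measurable_ξ j n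
  refine Measure.ext fun B hB => ?_
  have hBS : MeasurableSet (S ∩ B ×ˢ univ) := hS.inter (hB.prod .univ)
  have h := congrArg (fun m => m (S ∩ B ×ˢ univ)) (M.map_prod_coin x j n hA)
  beta_reduce at h
  rw [Measure.map_apply (hX.prodMk hξ) hBS, Measure.restrict_apply ((hX.prodMk hξ) hBS),
    Measure.prod_apply hBS] at h
  rw [Measure.map_apply hX hB, Measure.restrict_apply (hX hB), withDensity_apply _ hB,
    ← lintegral_indicator hB]
  convert h using 1
  · congr 1
    ext ω
    simp only [mem_inter_iff, mem_preimage, mem_prod, mem_ofPred_eq, mem_univ, and_true]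
    tauto
  · refine lintegral_congr fun y => ?_
    by_cases hy : y ∈ B
    · simp [hy]
    · have : Prod.mk y ⁻¹' (S ∩ B ×ˢ univ) = ∅ := by ext; simp [hy]
      simp [hy, this]

theorem map_coin_le (x : E) (j : Fin 2) (n : ℕ) {A : Set Ω}
    (hA : MeasurableSet[M.allExcept j n] A) {q : E → ℝ} (hq : Measurable q)
    (hq_mem : ∀ y, q y ∈ Icc (0 : ℝ) 1) :
    ((M.P x).restrict (A ∩ {ω | M.ξ j n ω ≤ q (M.X n ω)})).map (M.X n) =
      (((M.P x).restrict A).map (M.X n)).withDensity fun y => ENNReal.ofReal (q y) := by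
  have h := M.map_coin x j n hA (S := {z | z.2 ≤ q z.1})
    (measurableSet_le measurable_snd (hq.comp measurable_fst))
  simp only [mem_ofPred_eq] at h
  rw [h]
  congr 1
  ext y
  obtain ⟨h0, h1⟩ := hq_mem y
  have h2 : Prod.mk y ⁻¹' {z : E × ℝ | z.2 ≤ q z.1} = Iic (q y) := by ext; simp
  rw [h2, Measure.restrict_congr_set Ioo_ae_eq_Ioc, Measure.restrict_apply measurableSet_Iic,
    inter_comm, Ioc_inter_Iic, min_eq_right h1, Real.volume_Ioc, sub_zero]

theorem map_coin_gt (x : E) (j : Fin 2) (n : ℕ) {A : Set Ω}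
    (hA : MeasurableSet[M.allExcept j n] A) {q : E → ℝ} (hq : Measurable q)
    (hq_mem : ∀ y, q y ∈ Icc (0 : ℝ) 1) :
    ((M.P x).restrict (A ∩ {ω | q (M.X n ω) < M.ξ j n ω})).map (M.X n) =
      (((M.P x).restrict A).map (M.X n)).withDensity fun y => ENNReal.ofReal (1 - q y) := by
  have h := M.map_coin x j n hA (S := {z | q z.1 < z.2})
    (measurableSet_lt (hq.comp measurable_fst) measurable_snd)
  simp only [mem_ofPred_eq] at h
  rw [h]
  congr 1
  ext y
  obtain ⟨h0, h1⟩ := hq_mem y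
  have h2 : Prod.mk y ⁻¹' {z : E × ℝ | q z.1 < z.2} = Ioi (q y) := by ext; simp
  rw [h2, Measure.restrict_congr_set Ioo_ae_eq_Ioc, Measure.restrict_apply measurableSet_Ioi,
    inter_comm, Ioc_inter_Ioi, max_eq_right h0, Real.volume_Ioc]

end MarkovDynkin.Model

/-! ### Killing versus discounting -/

namespace MarkovDynkin.Model

variable {E Ω : Type*} [MeasurableSpace E] [MeasurableSpace Ω] {κ : Kernel E E} {α : ℝ}
  (M : Model κ α Ω)

/-- The discounted running supremum `supₙ αⁿ |u(Xₙ)|`. -/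
noncomputable def envelope (u : E → ℝ) (ω : Ω) : ℝ≥0∞ :=
  ⨆ n, ENNReal.ofReal α ^ n * ‖u (M.X n ω)‖ₑ

theorem measurable_envelope {u : E → ℝ} (hu : Measurable u) : Measurable (M.envelope u) :=
  .iSup fun n => ((hu.comp (M.measurable_X n)).enorm).const_mul _

/-- The coin sequences for which no killing occurs up to time `n`. -/
def unkilled (n : ℕ) : Set (ℕ → Bool) := {c | ∀ k, 0 < k → k ≤ n → c k = false}

theorem measurableSet_unkilled (n : ℕ) : MeasurableSet (unkilled n) := by
  have h : unkilled n = ⋂ k, ⋂ (_ : 0 < k), ⋂ (_ : k ≤ n),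
      (fun c : ℕ → Bool => c k) ⁻¹' {false} := by
    ext c; simp [unkilled]
  rw [h]
  exact .iInter fun k => .iInter fun _ => .iInter fun _ =>
    measurable_pi_apply k (measurableSet_singleton false)

theorem enorm_killed (u : E → ℝ) (n : ℕ) (ω : Ω) :
    ‖(M.killed n ω).elim 0 u‖ₑ =
      (unkilled n).indicator (fun _ => ‖u (M.X n ω)‖ₑ) (fun k => M.kill k ω) := by
  classical
  by_cases h : (fun k => M.kill k ω) ∈ unkilled n
  · have : ¬ ∃ k, 0 < k ∧ k ≤ n ∧ M.kill k ω = true := by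
      rintro ⟨k, h0, hn, hk⟩
      simp [h k h0 hn] at hk
    rw [indicator_of_mem h, killed, if_neg this, Option.elim_some]
  · have : ∃ k, 0 < k ∧ k ≤ n ∧ M.kill k ω = true := by
      simpa [unkilled] using h
    rw [indicator_of_notMem h, killed, if_pos this, Option.elim_none, enorm_zero]

theorem measure_unkilled (hα₁ : α < 1) (x : E) (n : ℕ) :
    (M.P x).map (fun ω k => M.kill k ω) (unkilled n) = ENNReal.ofReal α ^ n := by
  have := M.isProb x
  have hfalse : ∀ k, M.P x (M.kill k ⁻¹' {false}) = ENNReal.ofReal α := by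
    intro k
    have hc : M.kill k ⁻¹' {false} = {ω | M.kill k ω = true}ᶜ := by ext; simp
    have hα : 1 - ENNReal.ofReal (1 - α) = ENNReal.ofReal α := by
      rw [← ENNReal.ofReal_one, ← ENNReal.ofReal_sub _ (by linarith)]
      congr 1
      ring
    have htrue : MeasurableSet {ω | M.kill k ω = true} :=
      M.measurable_kill k (measurableSet_singleton true)
    rw [hc, prob_compl_eq_one_sub htrue, M.law_kill, hα]
  -- There is no killing at time `0`, so survival up to `n` involves the `n` coins `1, …, n`.
  have h := (M.iIndep_kill x).measure_inter_preimage_eq_mul (S := Finset.Icc 1 n)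
    (sets := fun _ => {false}) fun _ _ => measurableSet_singleton _
  simp only [hfalse, Finset.prod_const, Nat.card_Icc, Nat.add_sub_cancel] at h
  rw [Measure.map_apply (measurable_pi_lambda _ M.measurable_kill) (measurableSet_unkilled n), ← h]
  congr 1
  ext ω
  simp [unkilled, Nat.succ_le_iff]

theorem map_process_kill (x : E) :
    (M.P x).map (fun ω => ((fun n => M.X n ω), fun n => M.kill n ω)) =
      ((M.P x).map fun ω n => M.X n ω).prod ((M.P x).map fun ω n => M.kill n ω) := by
  have := M.isProb x
  exact (indepFun_iff_map_prod_eq_prod_map_map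
    (measurable_pi_lambda _ M.measurable_X).aemeasurable
    (measurable_pi_lambda _ M.measurable_kill).aemeasurable).1
    ((M.indep_kill x).comp measurable_fst measurable_id)

theorem lintegral_process_kill (x : E) {F : (ℕ → E) × (ℕ → Bool) → ℝ≥0∞} (hF : Measurable F) :
    ∫⁻ ω, F ((fun n => M.X n ω), fun n => M.kill n ω) ∂(M.P x) =
      ∫⁻ ω, ∫⁻ c, F ((fun n => M.X n ω), c) ∂((M.P x).map fun ω n => M.kill n ω) ∂(M.P x) := by
  have := M.isProb x
  have hX := measurable_pi_lambda (fun ω n => M.X n ω) M.measurable_X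
  have hK := measurable_pi_lambda (fun ω n => M.kill n ω) M.measurable_kill
  have := Measure.isProbabilityMeasure_map (μ := M.P x) hK.aemeasurable
  rw [← lintegral_map hF (hX.prodMk hK), M.map_process_kill, lintegral_prod _ hF.aemeasurable,
    lintegral_map hF.lintegral_prod_right' hX]

theorem measurable_killed_enorm {u : E → ℝ} (hu : Measurable u) (n : ℕ) :
    Measurable fun z : (ℕ → E) × (ℕ → Bool) =>
      (unkilled n).indicator (fun _ => ‖u (z.1 n)‖ₑ) z.2 := by
  have h : (fun z : (ℕ → E) × (ℕ → Bool) =>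
      (unkilled n).indicator (fun _ => ‖u (z.1 n)‖ₑ) z.2) =
      (Prod.snd ⁻¹' unkilled n).indicator fun z : (ℕ → E) × (ℕ → Bool) => ‖u (z.1 n)‖ₑ := by
    rfl
  rw [h]
  exact (hu.comp ((measurable_pi_apply n).comp measurable_fst)).enorm.indicator
    (measurable_snd (measurableSet_unkilled n))

theorem lintegral_enorm_killed (hα₁ : α < 1) {u : E → ℝ} (hu : Measurable u) (x : E) (n : ℕ) :
    ∫⁻ ω, ‖(M.killed n ω).elim 0 u‖ₑ ∂(M.P x) =
      ENNReal.ofReal α ^ n * ∫⁻ ω, ‖u (M.X n ω)‖ₑ ∂(M.P x) := by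
  simp_rw [M.enorm_killed]
  rw [M.lintegral_process_kill x (measurable_killed_enorm hu n)]
  simp only [lintegral_indicator_const (measurableSet_unkilled n), M.measure_unkilled hα₁]
  rw [lintegral_mul_const (f := fun ω => ‖u (M.X n ω)‖ₑ) _ (hu.comp (M.measurable_X n)).enorm,
    mul_comm]

/-- For a fixed path, averaging over the killing coins turns survival up to `n` into the factor
`αⁿ`, and the mean of a supremum dominates the supremum of the means. -/
theorem lintegral_envelope_lt_top (hα₁ : α < 1) {u : E → ℝ} (hu : Measurable u)
    (h : M.SupIntegrable u) (x : E) : ∫⁻ ω, M.envelope u ω ∂(M.P x) < ∞ := by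
  refine lt_of_le_of_lt ?_ (h x)
  simp_rw [M.enorm_killed]
  rw [M.lintegral_process_kill x
    (F := fun z => ⨆ n, (unkilled n).indicator (fun _ => ‖u (z.1 n)‖ₑ) z.2)
    (.iSup fun n => measurable_killed_enorm hu n)]
  refine lintegral_mono fun ω => iSup_le fun n => ?_
  rw [← M.measure_unkilled hα₁ x, mul_comm, ← lintegral_indicator_const (measurableSet_unkilled n)]
  exact lintegral_mono fun c => le_iSup
    (fun n => (unkilled n).indicator (fun _ => ‖u (M.X n ω)‖ₑ) c) n

theorem ae_exists_kill (hα₁ : α < 1) (x : E) :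
    ∀ᵐ ω ∂(M.P x), ∃ n, (fun k => M.kill k ω) ∉ unkilled n := by
  have := M.isProb x
  have hK := measurable_pi_lambda (fun ω n => M.kill n ω) M.measurable_kill
  rw [ae_iff]
  simp only [not_exists, not_not]
  refine le_antisymm (ge_of_tendsto' (ENNReal.tendsto_pow_atTop_nhds_zero_of_lt_one
    (ENNReal.ofReal_lt_one.2 hα₁)) fun n => ?_) bot_le
  rw [← M.measure_unkilled hα₁ x n, Measure.map_apply hK (measurableSet_unkilled n)]
  exact measure_mono fun ω hω => hω n

/-- The discounted moment is the mean of `|u|` along the killed process. Killing happens almost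
surely in finite time, so dominated convergence applies with the integrable supremum as bound. -/
theorem tendsto_discounted_lintegral (hα₁ : α < 1) {u : E → ℝ} (hu : Measurable u)
    (h : M.SupIntegrable u) (x : E) :
    Filter.Tendsto (fun n => ENNReal.ofReal α ^ n * ∫⁻ ω, ‖u (M.X n ω)‖ₑ ∂(M.P x))
      Filter.atTop (nhds 0) := by
  have hX := measurable_pi_lambda (fun ω n => M.X n ω) M.measurable_X
  have hK := measurable_pi_lambda (fun ω n => M.kill n ω) M.measurable_kill
  simp_rw [← M.lintegral_enorm_killed hα₁ hu]
  rw [← lintegral_zero (μ := M.P x)]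
  refine tendsto_lintegral_of_dominated_convergence _ (fun n => ?_)
    (fun n => ae_of_all _ fun ω => le_iSup (fun n => ‖(M.killed n ω).elim 0 u‖ₑ) n) (h x).ne ?_
  · simp_rw [M.enorm_killed]
    exact (measurable_killed_enorm hu n).comp (hX.prodMk hK)
  · filter_upwards [M.ae_exists_kill hα₁ x] with ω ⟨n, hn⟩
    refine tendsto_const_nhds.congr' ?_
    filter_upwards [Filter.eventually_ge_atTop n] with m hm
    rw [M.enorm_killed, indicator_of_notMem]
    exact fun hmem => hn fun k h0 hk => hmem k h0 (hk.trans hm)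

end MarkovDynkin.Model

/-! ### Randomized stopping times and the laws of the state before stopping -/

namespace MarkovDynkin.Model

variable {E Ω : Type*} [MeasurableSpace E] [MeasurableSpace Ω] {κ : Kernel E E} {α : ℝ}
  (M : Model κ α Ω)

/-- The randomized stopping time `inf {n : p n (Xₙ) ≥ ξⁱₙ}` of a time-dependent strategy. -/
noncomputable def seqTime (i : Fin 2) (p : ℕ → E → ℝ) (ω : Ω) : ℕ∞ :=
  ⨅ (n : ℕ) (_ : p n (M.X n ω) ≥ M.ξ i n ω), (n : ℕ∞)

theorem le_seqTime_iff {i : Fin 2} {p : ℕ → E → ℝ} {ω : Ω} {n : ℕ} :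
    (n : ℕ∞) ≤ M.seqTime i p ω ↔ ∀ k < n, p k (M.X k ω) < M.ξ i k ω := by
  simp only [seqTime, le_iInf_iff, Nat.cast_le, ge_iff_le]
  refine forall_congr' fun k => ?_
  rw [← not_lt, ← not_lt]
  tauto

theorem lt_seqTime_iff {i : Fin 2} {p : ℕ → E → ℝ} {ω : Ω} {n : ℕ} :
    (n : ℕ∞) < M.seqTime i p ω ↔
      (n : ℕ∞) ≤ M.seqTime i p ω ∧ p n (M.X n ω) < M.ξ i n ω := by
  rw [← ENat.add_one_le_iff (ENat.natCast_ne_top n)]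
  have : ((n : ℕ∞) + 1) = ((n + 1 : ℕ) : ℕ∞) := by simp
  rw [this, le_seqTime_iff, le_seqTime_iff, Nat.forall_lt_succ_right]

theorem seqTime_eq_iff {i : Fin 2} {p : ℕ → E → ℝ} {ω : Ω} {n : ℕ} :
    M.seqTime i p ω = n ↔ (n : ℕ∞) ≤ M.seqTime i p ω ∧ M.ξ i n ω ≤ p n (M.X n ω) := by
  have h := M.lt_seqTime_iff (i := i) (p := p) (ω := ω) (n := n)
  rw [← not_lt (b := M.ξ i n ω), eq_comm, eq_iff_le_not_lt, h]
  tauto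

/-- The σ-algebra ends strictly before `n`: the event leaves the coin of time `n` untouched, which
is what later permits integrating that coin out. -/
theorem measurableSet_le_seqTime {i : Fin 2} {p : ℕ → E → ℝ} (hp : ∀ n, Measurable (p n)) (n : ℕ) :
    MeasurableSet[⨆ k, ⨆ (_ : k < n), (MeasurableSpace.comap (M.X k) inferInstance ⊔
      MeasurableSpace.comap (M.ξ i k) inferInstance)] {ω | (n : ℕ∞) ≤ M.seqTime i p ω} := by
  simp_rw [le_seqTime_iff, ofPred_forall]
  refine MeasurableSet.iInter fun k => MeasurableSet.iInter fun hk => ?_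
  have hle := le_iSup₂ (f := fun k (_ : k < n) => MeasurableSpace.comap (M.X k) inferInstance ⊔
    MeasurableSpace.comap (M.ξ i k) inferInstance) k hk
  exact measurableSet_lt ((hp k).comp (Measurable.of_comap_le (le_sup_left.trans hle)))
    (Measurable.of_comap_le (le_sup_right.trans hle))

section SigmaAlgebras

theorem comap_X_le_filtration (i : Fin 2) {k n : ℕ} (h : k ≤ n) :
    MeasurableSpace.comap (M.X k) inferInstance ≤ M.filtration i n :=
  le_iSup₂_of_le (f := fun k (_ : k ≤ n) => MeasurableSpace.comap (M.X k) inferInstance ⊔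
    MeasurableSpace.comap (M.ξ i k) inferInstance) k h le_sup_left

theorem comap_ξ_le_filtration (i : Fin 2) {k n : ℕ} (h : k ≤ n) :
    MeasurableSpace.comap (M.ξ i k) inferInstance ≤ M.filtration i n :=
  le_iSup₂_of_le (f := fun k (_ : k ≤ n) => MeasurableSpace.comap (M.X k) inferInstance ⊔
    MeasurableSpace.comap (M.ξ i k) inferInstance) k h le_sup_right

theorem comap_X_le_pastAndNoise {k n : ℕ} (h : k ≤ n) :
    MeasurableSpace.comap (M.X k) inferInstance ≤ M.pastAndNoise n :=
  le_sup_of_le_left (le_iSup₂_of_le (f := fun k (_ : k ≤ n) =>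
    MeasurableSpace.comap (M.X k) inferInstance) k h le_rfl)

theorem comap_ξ_le_pastAndNoise (i : Fin 2) (k n : ℕ) :
    MeasurableSpace.comap (M.ξ i k) inferInstance ≤ M.pastAndNoise n :=
  le_sup_of_le_right (le_iSup (fun q : Fin 2 × ℕ =>
    MeasurableSpace.comap (M.ξ q.1 q.2) inferInstance) (i, k))

theorem comap_X_le_allExcept (j : Fin 2) (k n : ℕ) :
    MeasurableSpace.comap (M.X k) inferInstance ≤ M.allExcept j n :=
  le_sup_of_le_left (le_iSup (fun k => MeasurableSpace.comap (M.X k) inferInstance) k)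

theorem comap_ξ_le_allExcept {i j : Fin 2} {k n : ℕ} (h : (i, k) ≠ (j, n)) :
    MeasurableSpace.comap (M.ξ i k) inferInstance ≤ M.allExcept j n :=
  le_sup_of_le_right (le_iSup₂_of_le (f := fun (q : Fin 2 × ℕ)
    (_ : q ∈ ({(j, n)}ᶜ : Set (Fin 2 × ℕ))) =>
      MeasurableSpace.comap (M.ξ q.1 q.2) inferInstance) (i, k) h le_rfl)

theorem filtration_le_pastAndNoise (i : Fin 2) (n : ℕ) : M.filtration i n ≤ M.pastAndNoise n :=
  iSup₂_le fun _ hk => sup_le (M.comap_X_le_pastAndNoise hk) (M.comap_ξ_le_pastAndNoise _ _ _)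

theorem filtration_le_allExcept {i j : Fin 2} (h : i ≠ j) (n m : ℕ) :
    M.filtration i n ≤ M.allExcept j m :=
  iSup₂_le fun _ _ => sup_le (M.comap_X_le_allExcept _ _ _)
    (M.comap_ξ_le_allExcept fun he => h (Prod.ext_iff.1 he).1)

end SigmaAlgebras

section Admissible

variable {i : Fin 2} {σ : Ω → ℕ∞}

theorem admissible_measurableSet_gt (hσ : σ ∈ M.admissible i) (n : ℕ) :
    MeasurableSet[M.filtration i n] {ω | (n : ℕ∞) < σ ω} := by
  have h : {ω | (n : ℕ∞) < σ ω} = {ω | σ ω ≤ (n : ℕ∞)}ᶜ := by ext; simp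
  rw [h]
  exact MeasurableSet.compl (hσ n)

theorem admissible_measurableSet_ge (hσ : σ ∈ M.admissible i) (n : ℕ) :
    MeasurableSet[M.filtration i n] {ω | (n : ℕ∞) ≤ σ ω} := by
  cases n with
  | zero => simp
  | succ n =>
    have h : {ω | ((n + 1 : ℕ) : ℕ∞) ≤ σ ω} = {ω | (n : ℕ∞) < σ ω} := by
      ext ω
      rw [mem_ofPred_eq, mem_ofPred_eq, ← ENat.add_one_le_iff (ENat.natCast_ne_top n)]
      simp
    rw [h]
    exact (M.filtration i).mono n.le_succ _ (M.admissible_measurableSet_gt hσ n)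

theorem admissible_measurableSet_eq (hσ : σ ∈ M.admissible i) (n : ℕ) :
    MeasurableSet[M.filtration i n] {ω | σ ω = n} := by
  have h : {ω | σ ω = n} = {ω | (n : ℕ∞) ≤ σ ω} \ {ω | (n : ℕ∞) < σ ω} := by
    ext ω
    simp [le_antisymm_iff, and_comm]
  rw [h]
  exact (M.admissible_measurableSet_ge hσ n).diff (M.admissible_measurableSet_gt hσ n)

theorem admissible_measurable (hσ : σ ∈ M.admissible i) : Measurable σ :=
  ENat.measurable_iff.2 fun n => (M.filtration i).le n _ (M.admissible_measurableSet_eq hσ n)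

theorem seqTime_mem_admissible (i : Fin 2) {p : ℕ → E → ℝ} (hp : ∀ n, Measurable (p n)) :
    M.seqTime i p ∈ M.admissible i := by
  intro n
  have h : {ω | M.seqTime i p ω ≤ (n : ℕ∞)} = {ω | ((n + 1 : ℕ) : ℕ∞) ≤ M.seqTime i p ω}ᶜ := by
    ext ω
    rw [mem_compl_iff, mem_ofPred_eq, mem_ofPred_eq, ← not_lt,
      ← ENat.add_one_le_iff (ENat.natCast_ne_top n)]
    simp
  change MeasurableSet[M.filtration i n] {ω | M.seqTime i p ω ≤ (n : ℕ∞)}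
  rw [h]
  have hle : (⨆ k, ⨆ (_ : k < n + 1), (MeasurableSpace.comap (M.X k) inferInstance ⊔
      MeasurableSpace.comap (M.ξ i k) inferInstance)) ≤ M.filtration i n :=
    iSup₂_le fun k hk => sup_le (M.comap_X_le_filtration i (Nat.lt_succ_iff.1 hk))
      (M.comap_ξ_le_filtration i (Nat.lt_succ_iff.1 hk))
  exact MeasurableSet.compl (hle _ (M.measurableSet_le_seqTime hp (n + 1)))

end Admissible

section Laws

/-- The law of `Xₙ` on the event `A`, a measure of mass `P x A`. -/
noncomputable def lawOn (x : E) (A : Set Ω) (n : ℕ) : Measure E :=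
  ((M.P x).restrict A).map (M.X n)

instance (x : E) (A : Set Ω) (n : ℕ) : IsFiniteMeasure (M.lawOn x A n) := by
  have := M.isProb x
  unfold lawOn
  infer_instance

theorem lawOn_mono (x : E) {A B : Set Ω} (h : A ⊆ B) (n : ℕ) : M.lawOn x A n ≤ M.lawOn x B n :=
  Measure.map_mono (Measure.restrict_mono h le_rfl) (M.measurable_X n)

theorem lawOn_union (x : E) {A B : Set Ω} (h : Disjoint A B) (hB : MeasurableSet B) (n : ℕ) :
    M.lawOn x (A ∪ B) n = M.lawOn x A n + M.lawOn x B n := by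
  rw [lawOn, Measure.restrict_union h hB, Measure.map_add _ _ (M.measurable_X n)]
  rfl

theorem lintegral_lawOn (x : E) (A : Set Ω) (n : ℕ) {u : E → ℝ≥0∞} (hu : Measurable u) :
    ∫⁻ y, u y ∂(M.lawOn x A n) = ∫⁻ ω in A, u (M.X n ω) ∂(M.P x) :=
  lintegral_map hu (M.measurable_X n)

theorem integral_lawOn (x : E) (A : Set Ω) (n : ℕ) {u : E → ℝ} (hu : Measurable u) :
    ∫ y, u y ∂(M.lawOn x A n) = ∫ ω in A, u (M.X n ω) ∂(M.P x) :=
  integral_map (M.measurable_X n).aemeasurable hu.aestronglyMeasurable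

variable {j : Fin 2} {q : ℕ → E → ℝ} (hq : ∀ n, Measurable (q n))
  (hq_mem : ∀ n y, q n y ∈ Icc (0 : ℝ) 1)

include hq in
theorem measurableSet_inter_le_seqTime {n : ℕ} {A : Set Ω}
    (hA : MeasurableSet[M.allExcept j n] A) :
    MeasurableSet[M.allExcept j n] (A ∩ {ω | (n : ℕ∞) ≤ M.seqTime j q ω}) :=
  MeasurableSet.inter hA ((iSup₂_le fun k hk => sup_le (M.comap_X_le_allExcept j k n)
    (M.comap_ξ_le_allExcept fun he => hk.ne (Prod.ext_iff.1 he).2)) _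
      (M.measurableSet_le_seqTime hq n))

include hq hq_mem

/-- A player still in the game at `n` continues exactly when the coin of time `n` exceeds `q n`, and
neither `A` nor the event of being still in the game sees this coin. -/
theorem lawOn_lt_seqTime (x : E) {n : ℕ} {A : Set Ω} (hA : MeasurableSet[M.allExcept j n] A) :
    M.lawOn x (A ∩ {ω | (n : ℕ∞) < M.seqTime j q ω}) n =
      (M.lawOn x (A ∩ {ω | (n : ℕ∞) ≤ M.seqTime j q ω}) n).withDensity
        fun y => ENNReal.ofReal (1 - q n y) := by
  rw [lawOn, lawOn, ← M.map_coin_gt x j n (M.measurableSet_inter_le_seqTime hq hA) (hq n)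
    (hq_mem n)]
  simp_rw [lt_seqTime_iff, inter_assoc]
  rfl

theorem lawOn_seqTime_eq (x : E) {n : ℕ} {A : Set Ω} (hA : MeasurableSet[M.allExcept j n] A) :
    M.lawOn x (A ∩ {ω | M.seqTime j q ω = n}) n =
      (M.lawOn x (A ∩ {ω | (n : ℕ∞) ≤ M.seqTime j q ω}) n).withDensity
        fun y => ENNReal.ofReal (q n y) := by
  rw [lawOn, lawOn, ← M.map_coin_le x j n (M.measurableSet_inter_le_seqTime hq hA) (hq n)
    (hq_mem n)]
  simp_rw [seqTime_eq_iff, inter_assoc]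
  rfl

/-- Surviving round `n` contributes the density `1 - q n`, after which the state moves by `κ`. The
condition `i ≠ j` keeps the event `n < σ` independent of the opponent's coin at time `n`. -/
theorem lawOn_succ [IsMarkovKernel κ] (x : E) {i : Fin 2} (hij : i ≠ j) {σ : Ω → ℕ∞}
    (hσ : σ ∈ M.admissible i) (n : ℕ) :
    M.lawOn x ({ω | ((n + 1 : ℕ) : ℕ∞) ≤ σ ω} ∩ {ω | ((n + 1 : ℕ) : ℕ∞) ≤ M.seqTime j q ω}) (n + 1)
      = κ ∘ₘ (M.lawOn x ({ω | (n : ℕ∞) < σ ω} ∩ {ω | (n : ℕ∞) ≤ M.seqTime j q ω}) n).withDensity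
        fun y => ENNReal.ofReal (1 - q n y) := by
  have hsucc : ∀ s : ℕ∞, ((n + 1 : ℕ) : ℕ∞) ≤ s ↔ (n : ℕ∞) < s := fun s => by
    rw [← ENat.add_one_le_iff (ENat.natCast_ne_top n)]
    simp
  have hA := M.admissible_measurableSet_gt hσ n
  have hle : (⨆ k, ⨆ (_ : k < n + 1), (MeasurableSpace.comap (M.X k) inferInstance ⊔
      MeasurableSpace.comap (M.ξ j k) inferInstance)) ≤ M.pastAndNoise n :=
    iSup₂_le fun k hk => sup_le (M.comap_X_le_pastAndNoise (Nat.lt_succ_iff.1 hk))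
      (M.comap_ξ_le_pastAndNoise j k n)
  have hB := hle _ (M.measurableSet_le_seqTime hq (n + 1))
  rw [← M.lawOn_lt_seqTime hq hq_mem x (M.filtration_le_allExcept hij n n _ hA)]
  simp_rw [hsucc] at hB ⊢
  exact M.map_next x n (MeasurableSet.inter (M.filtration_le_pastAndNoise i n _ hA) hB)

end Laws

end MarkovDynkin.Model

/-! ### Real integrals against densities and kernels -/

theorem MeasureTheory.integral_withDensity_ofReal {X : Type*} [MeasurableSpace X] {μ : Measure X}
    {w : X → ℝ} (hw : Measurable w) (hw₀ : ∀ y, 0 ≤ w y) (u : X → ℝ) :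
    ∫ y, u y ∂(μ.withDensity fun y => ENNReal.ofReal (w y)) = ∫ y, w y * u y ∂μ := by
  rw [integral_withDensity_eq_integral_toReal_smul hw.ennreal_ofReal
    (ae_of_all _ fun _ => ENNReal.ofReal_lt_top)]
  simp [ENNReal.toReal_ofReal (hw₀ _)]

theorem MeasureTheory.integral_withDensity_ofReal_one_sub {X : Type*} [MeasurableSpace X]
    {μ : Measure X} {w : X → ℝ} (hw : Measurable w) (hw₁ : ∀ y, w y ≤ 1) (u : X → ℝ) :
    ∫ y, u y ∂(μ.withDensity fun y => ENNReal.ofReal (1 - w y)) = ∫ y, (1 - w y) * u y ∂μ :=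
  integral_withDensity_ofReal (measurable_const.sub hw) (fun y => sub_nonneg.2 (hw₁ y)) u

theorem MeasureTheory.Integrable.mul_of_mem_Icc {X : Type*} [MeasurableSpace X] {μ : Measure X}
    {w u : X → ℝ} (hu : Integrable u μ) (hw : Measurable w) (hw' : ∀ y, w y ∈ Icc (0 : ℝ) 1) :
    Integrable (fun y => w y * u y) μ :=
  hu.bdd_mul (c := 1) hw.aestronglyMeasurable (ae_of_all _ fun y => by
    rw [Real.norm_eq_abs, abs_of_nonneg (hw' y).1]
    exact (hw' y).2)

theorem MeasureTheory.integral_bind_kernel {X Y : Type*} [MeasurableSpace X] [MeasurableSpace Y]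
    {μ : Measure X} {κ : Kernel X Y} {u : Y → ℝ} (hu : Integrable u (κ ∘ₘ μ)) :
    ∫ y, u y ∂(κ ∘ₘ μ) = ∫ x, ∫ y, u y ∂(κ x) ∂μ := by
  rw [Measure.comp_eq_comp_const_apply] at hu ⊢
  rw [Kernel.integral_comp hu, Kernel.const_apply]

theorem MeasureTheory.Integrable.integral_bind_kernel {X Y : Type*} [MeasurableSpace X]
    [MeasurableSpace Y] {μ : Measure X} {κ : Kernel X Y} {u : Y → ℝ} (hu : Integrable u (κ ∘ₘ μ)) :
    Integrable (fun x => ∫ y, u y ∂(κ x)) μ := by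
  rw [Measure.comp_eq_comp_const_apply] at hu
  simpa using hu.integral_comp

/-! ### Expected reward split by the time at which the game ends -/

namespace MarkovDynkin.Model

variable {E Ω : Type*} [MeasurableSpace E] [MeasurableSpace Ω] {κ : Kernel E E} {α : ℝ}
  (M : Model κ α Ω)

section Reward

variable {G : Payoffs E} {i : Fin 2} {τ : Fin 2 → Ω → ℕ∞} {ω : Ω} {n : ℕ}

theorem reward_of_eq_of_lt (h₁ : τ i ω = n) (h₂ : (n : ℕ∞) < τ (1 - i) ω) :
    M.reward G i τ ω = α ^ n * G.f i (M.X n ω) := by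
  simp [reward, h₁, h₂]

theorem reward_of_lt_of_eq (h₁ : (n : ℕ∞) < τ i ω) (h₂ : τ (1 - i) ω = n) :
    M.reward G i τ ω = α ^ n * G.g i (M.X n ω) := by
  simp [reward, h₁, h₂, h₁.not_gt]

theorem reward_of_eq_of_eq (h₁ : τ i ω = n) (h₂ : τ (1 - i) ω = n) :
    M.reward G i τ ω = α ^ n * G.h i (M.X n ω) := by
  simp [reward, h₁, h₂]

theorem reward_of_top (h₁ : τ i ω = ⊤) (h₂ : τ (1 - i) ω = ⊤) : M.reward G i τ ω = 0 := by
  simp [reward, h₁, h₂]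

theorem enorm_reward_le (hα₀ : 0 < α) (G : Payoffs E) (i : Fin 2) (τ : Fin 2 → Ω → ℕ∞) (ω : Ω) :
    ‖M.reward G i τ ω‖ₑ ≤
      M.envelope (G.f i) ω + M.envelope (G.g i) ω + M.envelope (G.h i) ω := by
  have key : ∀ (u : E → ℝ) (n : ℕ), ‖α ^ n * u (M.X n ω)‖ₑ ≤ M.envelope u ω := fun u n => by
    rw [enorm_mul, enorm_pow, Real.enorm_eq_ofReal hα₀.le]
    exact le_iSup (fun n => ENNReal.ofReal α ^ n * ‖u (M.X n ω)‖ₑ) n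
  unfold reward
  dsimp only
  split_ifs
  · exact (key _ _).trans (le_add_right le_self_add)
  · exact (key _ _).trans (le_add_right le_add_self)
  · exact (key _ _).trans le_add_self
  · simp

theorem measurable_reward (hf : Measurable (G.f i)) (hg : Measurable (G.g i))
    (hh : Measurable (G.h i)) (h₁ : Measurable (τ i)) (h₂ : Measurable (τ (1 - i))) :
    Measurable (M.reward G i τ) := by
  have key : ∀ {u : E → ℝ} {s : Ω → ℕ∞}, Measurable u → Measurable s →
      Measurable fun ω => α ^ (s ω).toNat * u (M.X (s ω).toNat ω) := fun {u s} hu hs => by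
    have h : Measurable fun z : ℕ∞ × Ω => α ^ z.1.toNat * u (M.X z.1.toNat z.2) :=
      measurable_from_prod_countable_right fun m =>
        (hu.comp (M.measurable_X m.toNat)).const_mul (α ^ m.toNat)
    exact h.comp (hs.prodMk measurable_id)
  have hlt : ∀ {s t : Ω → ℕ∞}, Measurable s → Measurable t → MeasurableSet {ω | s ω < t ω} :=
    fun hs ht => (hs.prodMk ht) (MeasurableSet.of_discrete (s := {z : ℕ∞ × ℕ∞ | z.1 < z.2}))
  exact .ite (hlt h₁ h₂) (key hf h₁) (.ite (hlt h₂ h₁) (key hg h₂)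
    (.ite (hlt h₁ measurable_const) (key hh h₁) measurable_const))

theorem integrable_reward (hα₀ : 0 < α) (hα₁ : α < 1) (hf : Measurable (G.f i))
    (hg : Measurable (G.g i)) (hh : Measurable (G.h i)) (hG : M.PayoffsIntegrable G)
    (h₁ : Measurable (τ i)) (h₂ : Measurable (τ (1 - i))) (x : E) :
    Integrable (M.reward G i τ) (M.P x) := by
  refine ⟨(M.measurable_reward hf hg hh h₁ h₂).aestronglyMeasurable, ?_⟩
  refine (lintegral_mono fun ω => M.enorm_reward_le hα₀ G i τ ω).trans_lt ?_
  rw [lintegral_add_right _ (M.measurable_envelope hh),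
    lintegral_add_right _ (M.measurable_envelope hg)]
  obtain ⟨h1, h2, h3⟩ := hG i
  exact ENNReal.add_lt_top.2 ⟨ENNReal.add_lt_top.2 ⟨M.lintegral_envelope_lt_top hα₁ hf h1 x,
    M.lintegral_envelope_lt_top hα₁ hg h2 x⟩, M.lintegral_envelope_lt_top hα₁ hh h3 x⟩

end Reward

theorem integrable_lawOn (hα₀ : 0 < α) (hα₁ : α < 1) {u : E → ℝ} (hu : Measurable u)
    (h : M.SupIntegrable u) (x : E) (A : Set Ω) (n : ℕ) : Integrable u (M.lawOn x A n) := by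
  refine ⟨hu.aestronglyMeasurable, ?_⟩
  rw [HasFiniteIntegral, M.lintegral_lawOn x A n hu.enorm]
  refine (setLIntegral_le_lintegral _ _).trans_lt ?_
  -- Here `α > 0` enters: the envelope bounds only the discounted moment, and `αⁿ` has to be divided
  -- out.
  have hpow : ENNReal.ofReal α ^ n ≠ 0 := pow_ne_zero n (ENNReal.ofReal_pos.2 hα₀).ne'
  have hlt : ENNReal.ofReal α ^ n * ∫⁻ ω, ‖u (M.X n ω)‖ₑ ∂(M.P x) < ∞ := by
    rw [← lintegral_const_mul (f := fun ω => ‖u (M.X n ω)‖ₑ) _ (hu.comp (M.measurable_X n)).enorm]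
    exact (lintegral_mono fun ω =>
      le_iSup (fun n => ENNReal.ofReal α ^ n * ‖u (M.X n ω)‖ₑ) n).trans_lt
      (M.lintegral_envelope_lt_top hα₁ hu h x)
  exact (ENNReal.mul_lt_top_iff.1 hlt).elim And.right fun h0 =>
    h0.elim (fun h0 => absurd h0 hpow) fun h0 => h0 ▸ ENNReal.zero_lt_top

theorem lawOn_univ_zero (x : E) : M.lawOn x univ 0 = Measure.dirac x := by
  rw [lawOn, Measure.restrict_univ, M.start]

/-- The law of `Xₙ` when `s` stops at time `n` and `t` has not stopped before. -/
noncomputable def stopLaw (x : E) (s t : Ω → ℕ∞) (n : ℕ) : Measure E :=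
  M.lawOn x ({ω | s ω = n} ∩ {ω | (n : ℕ∞) ≤ t ω}) n

/-- The law of `Xₙ` when `s` has not stopped up to time `n` and `t` has not stopped before. -/
noncomputable def contLaw (x : E) (s t : Ω → ℕ∞) (n : ℕ) : Measure E :=
  M.lawOn x ({ω | (n : ℕ∞) < s ω} ∩ {ω | (n : ℕ∞) ≤ t ω}) n

/-- The law of `Xₙ` when neither `s` nor `t` has stopped before time `n`. -/
noncomputable def aliveLaw (x : E) (s t : Ω → ℕ∞) (n : ℕ) : Measure E :=
  M.lawOn x ({ω | (n : ℕ∞) ≤ s ω} ∩ {ω | (n : ℕ∞) ≤ t ω}) n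

theorem aliveLaw_zero (x : E) (s t : Ω → ℕ∞) : M.aliveLaw x s t 0 = Measure.dirac x := by
  simp [aliveLaw, ← M.lawOn_univ_zero x]

theorem aliveLaw_eq_add (x : E) {i j : Fin 2} {s t : Ω → ℕ∞} (hs : s ∈ M.admissible i)
    (ht : t ∈ M.admissible j) (n : ℕ) :
    M.aliveLaw x s t n = M.stopLaw x s t n + M.contLaw x s t n := by
  rw [aliveLaw, stopLaw, contLaw, ← M.lawOn_union]
  · congr 1
    ext ω
    simp only [mem_inter_iff, mem_ofPred_eq, mem_union, le_iff_eq_or_lt (a := (n : ℕ∞)) (b := s ω)]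
    rw [eq_comm (a := s ω)]
    tauto
  · refine disjoint_left.2 fun ω h h' => ?_
    have h1 : s ω = n := h.1
    have h2 : (n : ℕ∞) < s ω := h'.1
    exact h2.ne' h1
  · exact ((M.filtration i).le n _ (M.admissible_measurableSet_gt hs n)).inter
      ((M.filtration j).le n _ (M.admissible_measurableSet_ge ht n))

/-- The event that the game with stopping times `s`, `t` ends at time `n`. -/
def endAt (s t : Ω → ℕ∞) (n : ℕ) : Set Ω := {ω | min (s ω) (t ω) = n}

omit [MeasurableSpace Ω] in
theorem endAt_eq_union (s t : Ω → ℕ∞) (n : ℕ) :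
    endAt s t n = ({ω | s ω = n} ∩ {ω | (n : ℕ∞) < t ω} ∪ {ω | s ω = n} ∩ {ω | t ω = n}) ∪
      {ω | (n : ℕ∞) < s ω} ∩ {ω | t ω = n} := by
  ext ω
  simp only [endAt, mem_ofPred_eq, mem_union, mem_inter_iff, min_eq_iff,
    le_iff_eq_or_lt]
  constructor
  · rintro (⟨h, h' | h'⟩ | ⟨h, h' | h'⟩)
    · exact .inl (.inr ⟨h, h' ▸ h⟩)
    · exact .inl (.inl ⟨h, h ▸ h'⟩)
    · exact .inl (.inr ⟨h' ▸ h, h⟩)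
    · exact .inr ⟨h ▸ h', h⟩
  · rintro ((⟨h, h'⟩ | ⟨h, h'⟩) | ⟨h, h'⟩)
    · exact .inl ⟨h, .inr (h ▸ h')⟩
    · exact .inl ⟨h, .inl (h.trans h'.symm)⟩
    · exact .inr ⟨h', .inr (h' ▸ h)⟩

omit [MeasurableSpace Ω] in
theorem pairwise_disjoint_endAt (s t : Ω → ℕ∞) :
    Pairwise (Function.onFun Disjoint (endAt s t)) := fun _ _ hmn =>
  disjoint_left.2 fun _ h h' => hmn (Nat.cast_injective (R := ℕ∞) (Eq.trans (Eq.symm h) h'))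

theorem measurableSet_endAt {s t : Ω → ℕ∞} (hs : Measurable s) (ht : Measurable t) (n : ℕ) :
    MeasurableSet (endAt s t n) :=
  (hs.prodMk ht) (MeasurableSet.of_discrete (s := {z : ℕ∞ × ℕ∞ | min z.1 z.2 = n}))

theorem reward_eq_zero {G : Payoffs E} {i : Fin 2} {τ : Fin 2 → Ω → ℕ∞} {ω : Ω}
    (h : ω ∉ ⋃ n, endAt (τ i) (τ (1 - i)) n) : M.reward G i τ ω = 0 := by
  have hmin : min (τ i ω) (τ (1 - i) ω) = ⊤ := by
    by_contra hne
    obtain ⟨n, hn⟩ := ENat.ne_top_iff_exists.1 hne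
    exact h (mem_iUnion.2 ⟨n, hn.symm⟩)
  rw [min_eq_top] at hmin
  exact M.reward_of_top hmin.1 hmin.2

/-- Nothing is lost off the union of the ending events: there both times are infinite and the reward
is `0`. -/
theorem hasSum_J {G : Payoffs E} {i : Fin 2} {τ : Fin 2 → Ω → ℕ∞} {x : E}
    (h₁ : Measurable (τ i)) (h₂ : Measurable (τ (1 - i)))
    (hint : Integrable (M.reward G i τ) (M.P x)) :
    HasSum (fun n => ∫ ω in endAt (τ i) (τ (1 - i)) n, M.reward G i τ ω ∂(M.P x))
      (M.J G i x τ) := by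
  have h := hasSum_integral_iUnion (fun n => measurableSet_endAt h₁ h₂ n)
    (pairwise_disjoint_endAt (τ i) (τ (1 - i))) hint.integrableOn
  rwa [setIntegral_eq_integral_of_forall_compl_eq_zero fun ω hω => M.reward_eq_zero hω] at h

section Step

variable {G : Payoffs E} {i : Fin 2} {τ : Fin 2 → Ω → ℕ∞} {q : ℕ → E → ℝ}

theorem one_sub_ne (i : Fin 2) : i ≠ 1 - i := by fin_cases i <;> simp

/-- Ending at `n` means that the player stops alone, both stop, or the opponent stops alone. The
laws on the right leave the opponent's decision at `n` open, so that decision appears only through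
the weights `1 - q n` and `q n`. -/
theorem setIntegral_reward (hα₀ : 0 < α) (hα₁ : α < 1) (hf : Measurable (G.f i))
    (hg : Measurable (G.g i)) (hh : Measurable (G.h i)) (hG : M.PayoffsIntegrable G)
    (hσ : τ i ∈ M.admissible i) (hq : ∀ n, Measurable (q n))
    (hq_mem : ∀ n y, q n y ∈ Icc (0 : ℝ) 1) (hτ : τ (1 - i) = M.seqTime (1 - i) q)
    (x : E) (n : ℕ) :
    ∫ ω in endAt (τ i) (τ (1 - i)) n, M.reward G i τ ω ∂(M.P x) =
      α ^ n * (∫ y, ((1 - q n y) * G.f i y + q n y * G.h i y) ∂(M.stopLaw x (τ i) (τ (1 - i)) n) +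
        ∫ y, q n y * G.g i y ∂(M.contLaw x (τ i) (τ (1 - i)) n)) := by
  have h₁ := M.admissible_measurable hσ
  have h₂ : Measurable (τ (1 - i)) :=
    hτ ▸ M.admissible_measurable (M.seqTime_mem_admissible (1 - i) hq)
  obtain ⟨hfi, hgi, hhi⟩ := hG i
  have hint := M.integrable_reward hα₀ hα₁ hf hg hh hG h₁ h₂ x
  have hw : Measurable fun y => 1 - q n y := measurable_const.sub (hq n)
  have hw_mem : ∀ y, 1 - q n y ∈ Icc (0 : ℝ) 1 := fun y =>
    ⟨by linarith [(hq_mem n y).2], by linarith [(hq_mem n y).1]⟩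
  have hS1 : MeasurableSet {ω | τ i ω = n} := h₁ (measurableSet_singleton _)
  have hS2 : MeasurableSet {ω | τ (1 - i) ω = n} := h₂ (measurableSet_singleton _)
  have hS3 : MeasurableSet {ω | (n : ℕ∞) < τ i ω} :=
    (M.filtration i).le n _ (M.admissible_measurableSet_gt hσ n)
  have hS4 : MeasurableSet {ω | (n : ℕ∞) < τ (1 - i) ω} :=
    h₂ (MeasurableSet.of_discrete (s := Ioi _))
  have hA := M.filtration_le_allExcept (one_sub_ne i) n n _ (M.admissible_measurableSet_eq hσ n)
  have hB := M.filtration_le_allExcept (one_sub_ne i) n n _ (M.admissible_measurableSet_gt hσ n)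
  have e1 : ∫ ω in {ω | τ i ω = n} ∩ {ω | (n : ℕ∞) < τ (1 - i) ω}, M.reward G i τ ω ∂(M.P x) =
      α ^ n * ∫ y, (1 - q n y) * G.f i y ∂(M.stopLaw x (τ i) (τ (1 - i)) n) := by
    rw [setIntegral_congr_fun (hS1.inter hS4) fun ω hω => M.reward_of_eq_of_lt hω.1 hω.2,
      integral_const_mul, ← M.integral_lawOn x _ n hf, stopLaw, hτ,
      M.lawOn_lt_seqTime hq hq_mem x hA, integral_withDensity_ofReal hw fun y => (hw_mem y).1]
  have e2 : ∫ ω in {ω | τ i ω = n} ∩ {ω | τ (1 - i) ω = n}, M.reward G i τ ω ∂(M.P x) =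
      α ^ n * ∫ y, q n y * G.h i y ∂(M.stopLaw x (τ i) (τ (1 - i)) n) := by
    rw [setIntegral_congr_fun (hS1.inter hS2) fun ω hω => M.reward_of_eq_of_eq hω.1 hω.2,
      integral_const_mul, ← M.integral_lawOn x _ n hh, stopLaw, hτ,
      M.lawOn_seqTime_eq hq hq_mem x hA, integral_withDensity_ofReal (hq n) fun y => (hq_mem n y).1]
  have e3 : ∫ ω in {ω | (n : ℕ∞) < τ i ω} ∩ {ω | τ (1 - i) ω = n}, M.reward G i τ ω ∂(M.P x) =
      α ^ n * ∫ y, q n y * G.g i y ∂(M.contLaw x (τ i) (τ (1 - i)) n) := by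
    rw [setIntegral_congr_fun (hS3.inter hS2) fun ω hω => M.reward_of_lt_of_eq hω.1 hω.2,
      integral_const_mul, ← M.integral_lawOn x _ n hg, contLaw, hτ,
      M.lawOn_seqTime_eq hq hq_mem x hB, integral_withDensity_ofReal (hq n) fun y => (hq_mem n y).1]
  have d1 : Disjoint ({ω | τ i ω = n} ∩ {ω | (n : ℕ∞) < τ (1 - i) ω})
      ({ω | τ i ω = n} ∩ {ω | τ (1 - i) ω = n}) :=
    disjoint_left.2 fun ω h h' => (show (n : ℕ∞) < τ (1 - i) ω from h.2).ne' h'.2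
  have d2 : Disjoint ({ω | τ i ω = n} ∩ {ω | (n : ℕ∞) < τ (1 - i) ω} ∪
      {ω | τ i ω = n} ∩ {ω | τ (1 - i) ω = n}) ({ω | (n : ℕ∞) < τ i ω} ∩ {ω | τ (1 - i) ω = n}) :=
    disjoint_left.2 fun ω h h' =>
      (show (n : ℕ∞) < τ i ω from h'.1).ne' (h.elim And.left And.left)
  rw [endAt_eq_union, setIntegral_union d2 (hS3.inter hS2) hint.integrableOn hint.integrableOn,
    setIntegral_union d1 (hS1.inter hS2) hint.integrableOn hint.integrableOn, e1, e2, e3,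
    integral_add (μ := M.stopLaw x (τ i) (τ (1 - i)) n)
      ((M.integrable_lawOn hα₀ hα₁ hf hfi x _ n).mul_of_mem_Icc hw hw_mem)
      ((M.integrable_lawOn hα₀ hα₁ hh hhi x _ n).mul_of_mem_Icc (hq n) (hq_mem n))]
  ring

end Step

end MarkovDynkin.Model

/-! ### Verification by telescoping -/

namespace MarkovDynkin.Model

variable {E Ω : Type*} [MeasurableSpace E] [MeasurableSpace Ω] {κ : Kernel E E} {α : ℝ}
  (M : Model κ α Ω)

section SeqTimes

variable {i j : Fin 2} (hij : i ≠ j) {p q : ℕ → E → ℝ} (hp : ∀ n, Measurable (p n))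
  (hp_mem : ∀ n y, p n y ∈ Icc (0 : ℝ) 1) (hq : ∀ n, Measurable (q n))

include hij hp hp_mem hq

theorem stopLaw_seqTime (x : E) (n : ℕ) :
    M.stopLaw x (M.seqTime i p) (M.seqTime j q) n =
      (M.aliveLaw x (M.seqTime i p) (M.seqTime j q) n).withDensity
        fun y => ENNReal.ofReal (p n y) := by
  rw [stopLaw, aliveLaw, inter_comm, M.lawOn_seqTime_eq hp hp_mem x
    (M.filtration_le_allExcept hij.symm n n _
      (M.admissible_measurableSet_ge (M.seqTime_mem_admissible j hq) n)), inter_comm]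

theorem contLaw_seqTime (x : E) (n : ℕ) :
    M.contLaw x (M.seqTime i p) (M.seqTime j q) n =
      (M.aliveLaw x (M.seqTime i p) (M.seqTime j q) n).withDensity
        fun y => ENNReal.ofReal (1 - p n y) := by
  rw [contLaw, aliveLaw, inter_comm, M.lawOn_lt_seqTime hp hp_mem x
    (M.filtration_le_allExcept hij.symm n n _
      (M.admissible_measurableSet_ge (M.seqTime_mem_admissible j hq) n)), inter_comm]

end SeqTimes

section Verification

variable [IsMarkovKernel κ] {G : Payoffs E} {i : Fin 2} {τ : Fin 2 → Ω → ℕ∞} {q V : E → ℝ}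
  (hα₀ : 0 < α) (hα₁ : α < 1) (hf : Measurable (G.f i)) (hg : Measurable (G.g i))
  (hh : Measurable (G.h i)) (hG : M.PayoffsIntegrable G) (hσ : τ i ∈ M.admissible i)
  (hq : Measurable q) (hq_mem : ∀ y, q y ∈ Icc (0 : ℝ) 1)
  (hτ : τ (1 - i) = M.seqTime (1 - i) fun _ => q) (hV : Measurable V) (hVint : M.SupIntegrable V)

/-- The law on the event is dominated by the full law of `Xₙ`, whose image under `κ` is the law of
`X (n + 1)`, where `V` is integrable. -/
theorem integrable_bind_contLaw (hα₀ : 0 < α) (hα₁ : α < 1) (s : Ω → ℕ∞) (j : Fin 2)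
    (hq : Measurable q) (hq_mem : ∀ y, q y ∈ Icc (0 : ℝ) 1) (hV : Measurable V)
    (hVint : M.SupIntegrable V) (x : E) (n : ℕ) :
    Integrable (fun y => (1 - q y) * (α * ∫ z, V z ∂(κ y)))
      (M.contLaw x s (M.seqTime j fun _ => q) n) := by
  have hn := M.map_next x n (A := univ) MeasurableSet.univ
  have h1 : Integrable V (κ ∘ₘ M.lawOn x univ n) := by
    have h2 := M.integrable_lawOn hα₀ hα₁ hV hVint x univ (n + 1)
    rwa [lawOn, hn] at h2
  have h3 : Integrable (fun y => ∫ z, V z ∂(κ y)) (M.contLaw x s (M.seqTime j fun _ => q) n) :=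
    h1.integral_bind_kernel.mono_measure (M.lawOn_mono x (subset_univ _) n)
  exact (h3.const_mul α).mul_of_mem_Icc (measurable_const.sub hq) fun y =>
    ⟨by linarith [(hq_mem y).2], by linarith [(hq_mem y).1]⟩

theorem integral_aliveLaw_succ (hα₀ : 0 < α) (hα₁ : α < 1) {s : Ω → ℕ∞} {i j : Fin 2}
    (hij : i ≠ j) (hs : s ∈ M.admissible i) (hq : Measurable q)
    (hq_mem : ∀ y, q y ∈ Icc (0 : ℝ) 1) (hV : Measurable V) (hVint : M.SupIntegrable V)
    (x : E) (n : ℕ) : α * ∫ y, V y ∂(M.aliveLaw x s (M.seqTime j fun _ => q) (n + 1)) =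
      ∫ y, (1 - q y) * (α * ∫ z, V z ∂(κ y)) ∂(M.contLaw x s (M.seqTime j fun _ => q) n) := by
  have hsucc := M.lawOn_succ (fun _ => hq) (fun _ => hq_mem) x hij hs n
  have hint := M.integrable_lawOn hα₀ hα₁ hV hVint x
    ({ω | ((n + 1 : ℕ) : ℕ∞) ≤ s ω} ∩ {ω | ((n + 1 : ℕ) : ℕ∞) ≤ M.seqTime j (fun _ => q) ω}) (n + 1)
  rw [hsucc] at hint
  rw [aliveLaw, hsucc, integral_bind_kernel hint, integral_withDensity_ofReal_one_sub
    hq (fun y => (hq_mem y).2), ← integral_const_mul, contLaw]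
  congr 1
  ext y
  ring

omit [IsMarkovKernel κ] in
theorem tendsto_integral_aliveLaw (hα₀ : 0 < α) (hα₁ : α < 1) (hV : Measurable V)
    (hVint : M.SupIntegrable V) (x : E) (s t : Ω → ℕ∞) :
    Filter.Tendsto (fun n => α ^ n * ∫ y, V y ∂(M.aliveLaw x s t n)) Filter.atTop (nhds 0) := by
  have h := M.tendsto_discounted_lintegral hα₁ hV hVint x
  rw [tendsto_zero_iff_enorm_tendsto_zero]
  refine tendsto_of_tendsto_of_tendsto_of_le_of_le tendsto_const_nhds h (fun _ => bot_le)
    fun n => ?_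
  rw [enorm_mul, enorm_pow, Real.enorm_eq_ofReal hα₀.le]
  gcongr
  refine (enorm_integral_le_lintegral_enorm _).trans ?_
  rw [aliveLaw, M.lintegral_lawOn x _ n hV.enorm]
  exact setLIntegral_le_lintegral _ _

include hα₀ hα₁ hf hg hh hG hσ hq hq_mem hτ hV hVint

/-- `V` is added and subtracted on the stopping part and on the continuing part. Their sum gives the
integral of `V` at time `n`, and the continuation term is its integral at time `n + 1`. -/
theorem setIntegral_reward_eq_sub (x : E) (n : ℕ) :
    ∫ ω in endAt (τ i) (τ (1 - i)) n, M.reward G i τ ω ∂(M.P x) =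
      α ^ n * ∫ y, V y ∂(M.aliveLaw x (τ i) (τ (1 - i)) n) -
        α ^ (n + 1) * ∫ y, V y ∂(M.aliveLaw x (τ i) (τ (1 - i)) (n + 1)) -
      α ^ n * (∫ y, (V y - ((1 - q y) * G.f i y + q y * G.h i y))
          ∂(M.stopLaw x (τ i) (τ (1 - i)) n) +
        ∫ y, (V y - ((1 - q y) * (α * ∫ z, V z ∂(κ y)) + q y * G.g i y))
          ∂(M.contLaw x (τ i) (τ (1 - i)) n)) := by
  obtain ⟨hfi, hgi, hhi⟩ := hG i
  have hw_mem : ∀ y, 1 - q y ∈ Icc (0 : ℝ) 1 := fun y =>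
    ⟨by linarith [(hq_mem y).2], by linarith [(hq_mem y).1]⟩
  have hw : Measurable fun y => 1 - q y := measurable_const.sub hq
  have hint := M.integrable_bind_contLaw hα₀ hα₁ (τ i) (1 - i) hq hq_mem hV hVint x n
  have hsucc := M.integral_aliveLaw_succ hα₀ hα₁ (one_sub_ne i) hσ hq hq_mem hV hVint x n
  rw [← hτ] at hint hsucc
  have hVl : ∀ A, Integrable V (M.lawOn x A n) := fun A => M.integrable_lawOn hα₀ hα₁ hV hVint x A n
  have iB : Integrable (fun y => (1 - q y) * G.f i y + q y * G.h i y)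
      (M.stopLaw x (τ i) (τ (1 - i)) n) :=
    ((M.integrable_lawOn hα₀ hα₁ hf hfi x _ n).mul_of_mem_Icc hw hw_mem).add
      ((M.integrable_lawOn hα₀ hα₁ hh hhi x _ n).mul_of_mem_Icc hq hq_mem)
  have iG : Integrable (fun y => q y * G.g i y) (M.contLaw x (τ i) (τ (1 - i)) n) :=
    (M.integrable_lawOn hα₀ hα₁ hg hgi x _ n).mul_of_mem_Icc hq hq_mem
  have iA : Integrable (fun y => (1 - q y) * (α * ∫ z, V z ∂(κ y)) + q y * G.g i y)
      (M.contLaw x (τ i) (τ (1 - i)) n) := hint.add iG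
  rw [M.setIntegral_reward hα₀ hα₁ hf hg hh hG hσ (fun _ => hq) (fun _ => hq_mem) hτ x n,
    integral_sub (μ := M.stopLaw x (τ i) (τ (1 - i)) n) (hVl _) iB,
    integral_sub (μ := M.contLaw x (τ i) (τ (1 - i)) n) (hVl _) iA,
    integral_add hint iG, ← hsucc,
    M.aliveLaw_eq_add x hσ (hτ ▸ M.seqTime_mem_admissible (1 - i) fun _ => hq) n,
    integral_add_measure (μ := M.stopLaw x (τ i) (τ (1 - i)) n)
      (ν := M.contLaw x (τ i) (τ (1 - i)) n) (hVl _) (hVl _), pow_succ]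
  ring

theorem J_le (x : E) (hhalt : ∀ y, (1 - q y) * G.f i y + q y * G.h i y ≤ V y)
    (hcont : ∀ y, (1 - q y) * (α * ∫ z, V z ∂(κ y)) + q y * G.g i y ≤ V y) :
    M.J G i x τ ≤ V x := by
  have h₂ : Measurable (τ (1 - i)) :=
    hτ ▸ M.admissible_measurable (M.seqTime_mem_admissible (1 - i) fun _ => hq)
  have h₁ := M.admissible_measurable hσ
  have hsum := (M.hasSum_J h₁ h₂
    (M.integrable_reward hα₀ hα₁ hf hg hh hG h₁ h₂ x)).tendsto_sum_nat
  have hlim := (M.tendsto_integral_aliveLaw hα₀ hα₁ hV hVint x (τ i) (τ (1 - i))).const_sub (V x)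
  rw [sub_zero] at hlim
  -- Supermartingale estimate: the rewards of the rounds before `n` sum to at most `V x` minus the
  -- discounted mean of `V` among those still playing at `n`.
  refine le_of_tendsto_of_tendsto' hsum hlim fun n => ?_
  induction n with
  | zero => simp [M.aliveLaw_zero, integral_dirac' _ _ hV.stronglyMeasurable]
  | succ n ih =>
    rw [Finset.sum_range_succ, M.setIntegral_reward_eq_sub hα₀ hα₁ hf hg hh hG hσ hq hq_mem hτ hV
      hVint x n]
    have h3 : 0 ≤ ∫ y, (V y - ((1 - q y) * G.f i y + q y * G.h i y))
          ∂(M.stopLaw x (τ i) (τ (1 - i)) n) := integral_nonneg fun y => sub_nonneg.2 (hhalt y)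
    have h4 : 0 ≤ ∫ y, (V y - ((1 - q y) * (α * ∫ z, V z ∂(κ y)) + q y * G.g i y))
          ∂(M.contLaw x (τ i) (τ (1 - i)) n) := integral_nonneg fun y => sub_nonneg.2 (hcont y)
    have h5 := mul_nonneg (pow_nonneg hα₀.le n) (add_nonneg h3 h4)
    linarith

/-- For a Markovian strategy the stopping and continuing laws have densities `p` and `1 - p`, so
each deficit is multiplied by a weight that is zero wherever the deficit may be nonzero. The bound
of `J_le` becomes an equality. -/
theorem J_eq {p : E → ℝ} (hp : Measurable p) (hp_mem : ∀ y, p y ∈ Icc (0 : ℝ) 1)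
    (hτi : τ i = M.seqTime i fun _ => p) (x : E)
    (hhalt : ∀ y, 0 < p y → (1 - q y) * G.f i y + q y * G.h i y = V y)
    (hcont : ∀ y, p y < 1 → (1 - q y) * (α * ∫ z, V z ∂(κ y)) + q y * G.g i y = V y) :
    M.J G i x τ = V x := by
  have h₂ : Measurable (τ (1 - i)) :=
    hτ ▸ M.admissible_measurable (M.seqTime_mem_admissible (1 - i) fun _ => hq)
  have h₁ := M.admissible_measurable hσ
  have hsum := (M.hasSum_J h₁ h₂
    (M.integrable_reward hα₀ hα₁ hf hg hh hG h₁ h₂ x)).tendsto_sum_nat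
  have hlim := (M.tendsto_integral_aliveLaw hα₀ hα₁ hV hVint x (τ i) (τ (1 - i))).const_sub (V x)
  rw [sub_zero] at hlim
  have hzero₁ : ∀ y, p y * (V y - ((1 - q y) * G.f i y + q y * G.h i y)) = 0 := fun y => by
    rcases (hp_mem y).1.eq_or_lt with h0 | h0
    · simp [← h0]
    · simp [hhalt y h0]
  have hzero₂ : ∀ y, (1 - p y) * (V y - ((1 - q y) * (α * ∫ z, V z ∂(κ y)) + q y * G.g i y)) = 0 :=
    fun y => by
      rcases (hp_mem y).2.eq_or_lt with h0 | h0
      · simp [h0]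
      · simp [hcont y h0]
  refine tendsto_nhds_unique hsum (hlim.congr fun n => ?_)
  induction n with
  | zero => simp [M.aliveLaw_zero, integral_dirac' _ _ hV.stronglyMeasurable]
  | succ n ih =>
    rw [Finset.sum_range_succ, M.setIntegral_reward_eq_sub hα₀ hα₁ hf hg hh hG hσ hq hq_mem hτ hV
      hVint x n, ← ih, hτi, hτ, M.stopLaw_seqTime (one_sub_ne i) (fun _ => hp) (fun _ => hp_mem)
      (fun _ => hq), M.contLaw_seqTime (one_sub_ne i) (fun _ => hp) (fun _ => hp_mem)
      (fun _ => hq), integral_withDensity_ofReal hp (fun y => (hp_mem y).1),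
      integral_withDensity_ofReal_one_sub hp (fun y => (hp_mem y).2)]
    simp only [hzero₁, hzero₂, integral_zero]
    ring

end Verification

end MarkovDynkin.Model

/-! ### Series representation of the payoff and the one-step formula -/

theorem MeasureTheory.Measure.sum_comp_kernel {ι X Y : Type*} [Countable ι] [MeasurableSpace X]
    [MeasurableSpace Y] (K : ι → Kernel X Y) (μ : Measure X) :
    Measure.sum (fun n => K n ∘ₘ μ) = Kernel.sum K ∘ₘ μ := by
  ext B hB
  simp only [Measure.sum_apply _ hB, Measure.bind_apply hB (Kernel.aemeasurable _),
    Kernel.sum_apply]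
  rw [lintegral_tsum fun n => ((K n).measurable_coe hB).aemeasurable]

namespace MarkovDynkin

variable {E Ω : Type*} [MeasurableSpace E] [MeasurableSpace Ω] {κ : Kernel E E} {α : ℝ}

/-- The strategy that uses `a` at time `0` and `b` later. -/
def firstThen (a b : E → ℝ) : ℕ → E → ℝ
  | 0 => a
  | _ + 1 => b

omit [MeasurableSpace E] in
theorem firstThen_self (a : E → ℝ) : firstThen a a = fun _ => a := by
  ext n; cases n <;> rfl

theorem measurable_firstThen {a b : E → ℝ} (ha : Measurable a) (hb : Measurable b) (n : ℕ) :
    Measurable (firstThen a b n) := by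
  cases n <;> assumption

omit [MeasurableSpace E] in
theorem firstThen_mem_Icc {a b : E → ℝ} (ha : ∀ y, a y ∈ Icc (0 : ℝ) 1)
    (hb : ∀ y, b y ∈ Icc (0 : ℝ) 1) (n : ℕ) (y : E) : firstThen a b n y ∈ Icc (0 : ℝ) 1 := by
  cases n
  exacts [ha y, hb y]

/-- The expected payment of one round in which the players stop with probabilities `p` and `q`. -/
def stageReward (f g h p q : E → ℝ) (y : E) : ℝ :=
  p y * ((1 - q y) * f y + q y * h y) + (1 - p y) * (q y * g y)

theorem measurable_stageReward {f g h p q : E → ℝ} (hf : Measurable f) (hg : Measurable g)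
    (hh : Measurable h) (hp : Measurable p) (hq : Measurable q) :
    Measurable (stageReward f g h p q) :=
  (hp.mul (((measurable_const.sub hq).mul hf).add (hq.mul hh))).add
    ((measurable_const.sub hp).mul (hq.mul hg))

theorem integrable_stageReward {f g h p q : E → ℝ} {μ : Measure E} (hf : Integrable f μ)
    (hg : Integrable g μ) (hh : Integrable h μ) (hp : Measurable p) (hq : Measurable q)
    (hp_mem : ∀ y, p y ∈ Icc (0 : ℝ) 1) (hq_mem : ∀ y, q y ∈ Icc (0 : ℝ) 1) :
    Integrable (stageReward f g h p q) μ := by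
  have hsub : ∀ {w : E → ℝ}, (∀ y, w y ∈ Icc (0 : ℝ) 1) → ∀ y, 1 - w y ∈ Icc (0 : ℝ) 1 :=
    fun hw y => ⟨sub_nonneg.2 (hw y).2, by linarith [(hw y).1]⟩
  exact (((hf.mul_of_mem_Icc (measurable_const.sub hq) (hsub hq_mem)).add
    (hh.mul_of_mem_Icc hq hq_mem)).mul_of_mem_Icc hp hp_mem).add
    ((hg.mul_of_mem_Icc hq hq_mem).mul_of_mem_Icc (measurable_const.sub hp) (hsub hp_mem))

omit [MeasurableSpace E] in
theorem abs_stageReward_le {f g h p q : E → ℝ} (hp_mem : ∀ y, p y ∈ Icc (0 : ℝ) 1)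
    (hq_mem : ∀ y, q y ∈ Icc (0 : ℝ) 1) (y : E) : |stageReward f g h p q y| ≤
      stageReward (fun y => |f y|) (fun y => |g y|) (fun y => |h y|) p q y := by
  have hp₀ := (hp_mem y).1
  have hp₁ := sub_nonneg.2 (hp_mem y).2
  have hq₀ := (hq_mem y).1
  have hq₁ := sub_nonneg.2 (hq_mem y).2
  unfold stageReward
  refine (abs_add_le _ _).trans (add_le_add ?_ ?_)
  · rw [abs_mul, abs_of_nonneg hp₀]
    refine mul_le_mul_of_nonneg_left ((abs_add_le _ _).trans (add_le_add ?_ ?_)) hp₀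
    · rw [abs_mul, abs_of_nonneg hq₁]
    · rw [abs_mul, abs_of_nonneg hq₀]
  · rw [abs_mul, abs_mul, abs_of_nonneg hp₁, abs_of_nonneg hq₀]

/-- The kernel `κ` weighted by the probability `c` of surviving the present round. -/
noncomputable def weighted (κ : Kernel E E) [IsSFiniteKernel κ] (c : E → ℝ) : Kernel E E :=
  κ.withDensity fun x _ => ENNReal.ofReal (c x)

theorem weighted_apply [IsSFiniteKernel κ] {c : E → ℝ} (hc : Measurable c) (x : E) :
    weighted κ c x = ENNReal.ofReal (c x) • κ x := by
  rw [weighted, Kernel.withDensity_apply _ (hc.comp measurable_fst).ennreal_ofReal,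
    withDensity_const]

theorem weighted_comp [IsSFiniteKernel κ] {c : E → ℝ} (hc : Measurable c) (μ : Measure E) :
    weighted κ c ∘ₘ μ = κ ∘ₘ μ.withDensity fun y => ENNReal.ofReal (c y) := by
  ext B hB
  rw [Measure.bind_apply hB (Kernel.aemeasurable _), Measure.bind_apply hB (Kernel.aemeasurable _),
    lintegral_withDensity_eq_lintegral_mul _ hc.ennreal_ofReal (κ.measurable_coe hB)]
  refine lintegral_congr fun y => ?_
  rw [weighted_apply hc]
  rfl

/-- The `n`-fold composition of a kernel with itself. -/
noncomputable def kernelIter (Q : Kernel E E) : ℕ → Kernel E E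
  | 0 => Kernel.id
  | n + 1 => Q ∘ₖ kernelIter Q n

namespace Model

variable (M : Model κ α Ω)

/-- The discounted law of `Xₙ` when neither `s` nor `t` has stopped before time `n`. -/
noncomputable def discountedLaw (x : E) (s t : Ω → ℕ∞) (n : ℕ) : Measure E :=
  ENNReal.ofReal α ^ n • M.aliveLaw x s t n

theorem discountedLaw_zero (x : E) (s t : Ω → ℕ∞) :
    M.discountedLaw x s t 0 = Measure.dirac x := by
  simp [discountedLaw, M.aliveLaw_zero]

theorem integral_discountedLaw (hα₀ : 0 < α) (x : E) (s t : Ω → ℕ∞) (n : ℕ) (u : E → ℝ) :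
    ∫ y, u y ∂(M.discountedLaw x s t n) = α ^ n * ∫ y, u y ∂(M.aliveLaw x s t n) := by
  rw [discountedLaw, integral_smul_measure, ENNReal.toReal_pow, ENNReal.toReal_ofReal hα₀.le,
    smul_eq_mul]

theorem integrable_discountedLaw (hα₀ : 0 < α) (hα₁ : α < 1) {u : E → ℝ} (hu : Measurable u)
    (h : M.SupIntegrable u) (x : E) (s t : Ω → ℕ∞) (n : ℕ) :
    Integrable u (M.discountedLaw x s t n) :=
  (M.integrable_lawOn hα₀ hα₁ hu h x _ n).smul_measure (ENNReal.pow_ne_top ENNReal.ofReal_ne_top)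

section Recursion

variable [IsMarkovKernel κ] {i j : Fin 2} (hij : i ≠ j) {p q : ℕ → E → ℝ}
  (hp : ∀ n, Measurable (p n)) (hp_mem : ∀ n y, p n y ∈ Icc (0 : ℝ) 1)
  (hq : ∀ n, Measurable (q n)) (hq_mem : ∀ n y, q n y ∈ Icc (0 : ℝ) 1)

include hij hp hp_mem hq hq_mem

theorem discountedLaw_succ (hα₀ : 0 < α) (x : E) (n : ℕ) :
    M.discountedLaw x (M.seqTime i p) (M.seqTime j q) (n + 1) =
      weighted κ (fun y => α * ((1 - p n y) * (1 - q n y))) ∘ₘ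
        M.discountedLaw x (M.seqTime i p) (M.seqTime j q) n := by
  have hsucc := M.lawOn_succ hq hq_mem x hij (M.seqTime_mem_admissible i hp) n
  have hcont := M.contLaw_seqTime hij hp hp_mem hq x n
  have hc : Measurable fun y => α * ((1 - p n y) * (1 - q n y)) :=
    ((measurable_const.sub (hp n)).mul (measurable_const.sub (hq n))).const_mul α
  have hmul : ∀ μ : Measure E, ((μ.withDensity fun y => ENNReal.ofReal (1 - p n y)).withDensity
      fun y => ENNReal.ofReal (1 - q n y)) = μ.withDensity fun y =>
        ENNReal.ofReal ((1 - p n y) * (1 - q n y)) := fun μ => by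
    rw [← withDensity_mul μ (f := fun y => ENNReal.ofReal (1 - p n y))
      (g := fun y => ENNReal.ofReal (1 - q n y)) (measurable_const.sub (hp n)).ennreal_ofReal
      (measurable_const.sub (hq n)).ennreal_ofReal]
    congr 1
    ext y
    rw [Pi.mul_apply, ENNReal.ofReal_mul (sub_nonneg.2 (hp_mem n y).2)]
  have hsmul : ∀ μ : Measure E, (μ.withDensity fun y =>
      ENNReal.ofReal (α * ((1 - p n y) * (1 - q n y)))) = ENNReal.ofReal α • μ.withDensity fun y =>
        ENNReal.ofReal ((1 - p n y) * (1 - q n y)) := fun μ => by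
    rw [← withDensity_smul' _ _ ENNReal.ofReal_ne_top]
    congr 1
    ext y
    rw [Pi.smul_apply, smul_eq_mul, ENNReal.ofReal_mul hα₀.le]
  rw [← contLaw, hcont, hmul] at hsucc
  rw [discountedLaw, aliveLaw, hsucc, weighted_comp hc, discountedLaw, withDensity_smul_measure,
    hsmul, Measure.bind_smul, Measure.bind_smul, pow_succ, mul_smul]

/-- Once both strategies are stationary, the recursion applies the same kernel in every round. -/
theorem discountedLaw_add (hα₀ : 0 < α) (x : E) {p' q' : E → ℝ} (m : ℕ) (hp' : ∀ n ≥ m, p n = p')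
    (hq' : ∀ n ≥ m, q n = q') (n : ℕ) :
    M.discountedLaw x (M.seqTime i p) (M.seqTime j q) (m + n) =
      kernelIter (weighted κ fun y => α * ((1 - p' y) * (1 - q' y))) n ∘ₘ
        M.discountedLaw x (M.seqTime i p) (M.seqTime j q) m := by
  induction n with
  | zero => simp [kernelIter]
  | succ n ih =>
    rw [← add_assoc, M.discountedLaw_succ hij hp hp_mem hq hq_mem hα₀, hp' _ (Nat.le_add_right m n),
      hq' _ (Nat.le_add_right m n), ih, Measure.comp_assoc]
    rfl

end Recursion

/-- The payoffs with all values replaced by their absolute values. -/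
def _root_.MarkovDynkin.Payoffs.abs (G : Payoffs E) : Payoffs E where
  f i y := |G.f i y|
  g i y := |G.g i y|
  h i y := |G.h i y|

theorem SupIntegrable.abs {u : E → ℝ} (h : M.SupIntegrable u) :
    M.SupIntegrable fun y => |u y| := by
  intro x
  convert h x using 5 with ω n
  cases M.killed n ω <;> simp

theorem PayoffsIntegrable.abs {G : Payoffs E} (h : M.PayoffsIntegrable G) :
    M.PayoffsIntegrable G.abs := fun i =>
  ⟨SupIntegrable.abs M (h i).1, SupIntegrable.abs M (h i).2.1, SupIntegrable.abs M (h i).2.2⟩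

section Series

variable [IsMarkovKernel κ] {G : Payoffs E} {i : Fin 2} {p q : ℕ → E → ℝ}
  {τ : Fin 2 → Ω → ℕ∞}
  (hα₀ : 0 < α) (hα₁ : α < 1) (hf : Measurable (G.f i)) (hg : Measurable (G.g i))
  (hh : Measurable (G.h i)) (hG : M.PayoffsIntegrable G)
  (hp : ∀ n, Measurable (p n)) (hp_mem : ∀ n y, p n y ∈ Icc (0 : ℝ) 1)
  (hq : ∀ n, Measurable (q n)) (hq_mem : ∀ n y, q n y ∈ Icc (0 : ℝ) 1)
  (hτ₁ : τ i = M.seqTime i p) (hτ₂ : τ (1 - i) = M.seqTime (1 - i) q)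

include hα₀ hα₁ hf hg hh hG hp hp_mem hq hq_mem hτ₁ hτ₂

omit [IsMarkovKernel κ] in
theorem hasSum_stageReward (x : E) :
    HasSum (fun n => ∫ y, stageReward (G.f i) (G.g i) (G.h i) (p n) (q n) y
      ∂(M.discountedLaw x (M.seqTime i p) (M.seqTime (1 - i) q) n)) (M.J G i x τ) := by
  have hσ : τ i ∈ M.admissible i := hτ₁ ▸ M.seqTime_mem_admissible i hp
  have h₁ := M.admissible_measurable hσ
  have h₂ : Measurable (τ (1 - i)) :=
    hτ₂ ▸ M.admissible_measurable (M.seqTime_mem_admissible (1 - i) hq)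
  refine (M.hasSum_J h₁ h₂ (M.integrable_reward hα₀ hα₁ hf hg hh hG h₁ h₂ x)).congr_fun ?_
  intro n
  have hsub : ∀ {w : E → ℝ}, (∀ y, w y ∈ Icc (0 : ℝ) 1) → ∀ y, 1 - w y ∈ Icc (0 : ℝ) 1 :=
    fun hw y => ⟨sub_nonneg.2 (hw y).2, by linarith [(hw y).1]⟩
  obtain ⟨hfi, hgi, hhi⟩ := hG i
  set μ := M.aliveLaw x (M.seqTime i p) (M.seqTime (1 - i) q) n with hμ
  have iF : Integrable (G.f i) μ := M.integrable_lawOn hα₀ hα₁ hf hfi x _ n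
  have iG : Integrable (G.g i) μ := M.integrable_lawOn hα₀ hα₁ hg hgi x _ n
  have iH : Integrable (G.h i) μ := M.integrable_lawOn hα₀ hα₁ hh hhi x _ n
  rw [M.setIntegral_reward hα₀ hα₁ hf hg hh hG hσ hq hq_mem hτ₂ x n,
    M.integral_discountedLaw hα₀, hτ₁, hτ₂,
    M.stopLaw_seqTime (one_sub_ne i) hp hp_mem hq, M.contLaw_seqTime (one_sub_ne i) hp hp_mem hq,
    integral_withDensity_ofReal (hp n) (fun y => (hp_mem n y).1),
    integral_withDensity_ofReal_one_sub (hp n) (fun y => (hp_mem n y).2), ← hμ,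
    ← integral_add]
  · rfl
  · exact ((iF.mul_of_mem_Icc (measurable_const.sub (hq n)) (hsub (hq_mem n))).add
      (iH.mul_of_mem_Icc (hq n) (hq_mem n))).mul_of_mem_Icc (hp n) (hp_mem n)
  · exact (iG.mul_of_mem_Icc (hq n) (hq_mem n)).mul_of_mem_Icc (measurable_const.sub (hp n))
      (hsub (hp_mem n))

/-- Absolute convergence comes from the series of the game with absolute payoffs, which meets the
same integrability assumption and dominates round by round. -/
theorem integrable_stageReward_sum (x : E) {p' q' : E → ℝ} (m : ℕ) (hp' : ∀ n ≥ m, p n = p')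
    (hq' : ∀ n ≥ m, q n = q') :
    Integrable (stageReward (G.f i) (G.g i) (G.h i) p' q')
      (Kernel.sum (kernelIter (weighted κ fun y => α * ((1 - p' y) * (1 - q' y)))) ∘ₘ
        M.discountedLaw x (M.seqTime i p) (M.seqTime (1 - i) q) m) := by
  have hGa := PayoffsIntegrable.abs M hG
  have habs := (M.hasSum_stageReward (G := G.abs) hα₀ hα₁ hf.abs hg.abs hh.abs hGa hp hp_mem hq
    hq_mem hτ₁ hτ₂ x).summable
  rw [← summable_nat_add_iff m] at habs
  have hint : ∀ n, Integrable (stageReward (G.f i) (G.g i) (G.h i) (p n) (q n))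
      (M.discountedLaw x (M.seqTime i p) (M.seqTime (1 - i) q) n) := fun n =>
    integrable_stageReward (M.integrable_discountedLaw hα₀ hα₁ hf (hG i).1 x _ _ n)
      (M.integrable_discountedLaw hα₀ hα₁ hg (hG i).2.1 x _ _ n)
      (M.integrable_discountedLaw hα₀ hα₁ hh (hG i).2.2 x _ _ n) (hp n) (hq n) (hp_mem n) (hq_mem n)
  have hinta : ∀ n, Integrable (stageReward (G.abs.f i) (G.abs.g i) (G.abs.h i) (p n) (q n))
      (M.discountedLaw x (M.seqTime i p) (M.seqTime (1 - i) q) n) := fun n =>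
    integrable_stageReward (M.integrable_discountedLaw hα₀ hα₁ hf.abs (hGa i).1 x _ _ n)
      (M.integrable_discountedLaw hα₀ hα₁ hg.abs (hGa i).2.1 x _ _ n)
      (M.integrable_discountedLaw hα₀ hα₁ hh.abs (hGa i).2.2 x _ _ n)
      (hp n) (hq n) (hp_mem n) (hq_mem n)
  rw [← Measure.sum_comp_kernel]
  simp_rw [← M.discountedLaw_add (one_sub_ne i) hp hp_mem hq hq_mem hα₀ x m hp' hq']
  refine integrable_sum_measure (fun n => ?_) (Summable.of_nonneg_of_le
    (fun n => integral_nonneg fun y => norm_nonneg _) (fun n => ?_) habs)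
  · have h := hint (m + n)
    rwa [hp' _ (Nat.le_add_right m n), hq' _ (Nat.le_add_right m n)] at h
  · have h := hint (m + n)
    have ha := hinta (m + n)
    rw [add_comm n m]
    rw [hp' _ (Nat.le_add_right m n), hq' _ (Nat.le_add_right m n)] at h ha ⊢
    exact integral_mono h.norm ha fun y => abs_stageReward_le
      (hp' m le_rfl ▸ hp_mem m) (hq' m le_rfl ▸ hq_mem m) y

/-- The tail is an average, over the state at time `m`, of a quantity built from `κ`, `p'` and `q'`
alone. The cases `m = 0` and `m = 1` are the ones used. -/
theorem J_eq_sum_add (x : E) {p' q' : E → ℝ} (m : ℕ) (hp' : ∀ n ≥ m, p n = p')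
    (hq' : ∀ n ≥ m, q n = q') :
    M.J G i x τ = ∑ n ∈ Finset.range m, ∫ y, stageReward (G.f i) (G.g i) (G.h i) (p n) (q n) y
      ∂(M.discountedLaw x (M.seqTime i p) (M.seqTime (1 - i) q) n) +
      ∫ y, ∫ z, stageReward (G.f i) (G.g i) (G.h i) p' q' z
        ∂(Kernel.sum (kernelIter (weighted κ fun y => α * ((1 - p' y) * (1 - q' y)))) y)
        ∂(M.discountedLaw x (M.seqTime i p) (M.seqTime (1 - i) q) m) := by
  have hint := M.integrable_stageReward_sum hα₀ hα₁ hf hg hh hG hp hp_mem hq hq_mem hτ₁ hτ₂ x m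
    hp' hq'
  have hsum := M.hasSum_stageReward hα₀ hα₁ hf hg hh hG hp hp_mem hq hq_mem hτ₁ hτ₂ x
  rw [← integral_bind_kernel hint, ← hsum.tsum_eq, ← hsum.summable.sum_add_tsum_nat_add m]
  congr 1
  rw [← Measure.sum_comp_kernel] at hint ⊢
  simp_rw [← M.discountedLaw_add (one_sub_ne i) hp hp_mem hq hq_mem hα₀ x m hp' hq'] at hint ⊢
  rw [← (hasSum_integral_measure hint).tsum_eq]
  refine tsum_congr fun n => ?_
  rw [add_comm n m, hp' _ (Nat.le_add_right m n), hq' _ (Nat.le_add_right m n)]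

end Series

section FirstStep

omit [MeasurableSpace E] in
theorem firstThen_of_one_le (a b : E → ℝ) : ∀ n ≥ 1, firstThen a b n = b
  | _ + 1, _ => rfl

theorem discountedLaw_one [IsMarkovKernel κ] (hα₀ : 0 < α) {i j : Fin 2} (hij : i ≠ j)
    {p₀ q₀ p q : E → ℝ} (hp₀ : Measurable p₀) (hp₀_mem : ∀ y, p₀ y ∈ Icc (0 : ℝ) 1)
    (hq₀ : Measurable q₀) (hq₀_mem : ∀ y, q₀ y ∈ Icc (0 : ℝ) 1) (hp : Measurable p)
    (hp_mem : ∀ y, p y ∈ Icc (0 : ℝ) 1) (hq : Measurable q) (hq_mem : ∀ y, q y ∈ Icc (0 : ℝ) 1)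
    (x : E) :
    M.discountedLaw x (M.seqTime i (firstThen p₀ p)) (M.seqTime j (firstThen q₀ q)) 1 =
      ENNReal.ofReal (α * ((1 - p₀ x) * (1 - q₀ x))) • κ x := by
  have hc : Measurable fun y => α * ((1 - p₀ y) * (1 - q₀ y)) :=
    ((measurable_const.sub hp₀).mul (measurable_const.sub hq₀)).const_mul α
  have h := M.discountedLaw_succ hij (measurable_firstThen hp₀ hp)
    (firstThen_mem_Icc hp₀_mem hp_mem) (measurable_firstThen hq₀ hq)
    (firstThen_mem_Icc hq₀_mem hq_mem) hα₀ x 0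
  rw [zero_add, discountedLaw_zero, Measure.dirac_bind (Kernel.measurable _)] at h
  rw [h]
  exact weighted_apply hc x

variable [IsMarkovKernel κ] {G : Payoffs E} {i : Fin 2} {p₀ q₀ p q V : E → ℝ}
  {τ ρ : Fin 2 → Ω → ℕ∞}
  (hα₀ : 0 < α) (hα₁ : α < 1) (hf : Measurable (G.f i)) (hg : Measurable (G.g i))
  (hh : Measurable (G.h i)) (hG : M.PayoffsIntegrable G)
  (hp₀ : Measurable p₀) (hp₀_mem : ∀ y, p₀ y ∈ Icc (0 : ℝ) 1)
  (hq₀ : Measurable q₀) (hq₀_mem : ∀ y, q₀ y ∈ Icc (0 : ℝ) 1)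
  (hp : Measurable p) (hp_mem : ∀ y, p y ∈ Icc (0 : ℝ) 1)
  (hq : Measurable q) (hq_mem : ∀ y, q y ∈ Icc (0 : ℝ) 1)
  (hρ₁ : ρ i = M.markovTime i p) (hρ₂ : ρ (1 - i) = M.markovTime (1 - i) q)
  (hV : ∀ x, V x = M.J G i x ρ)

include hα₀ hα₁ hf hg hh hG hp hp_mem hq hq_mem hρ₁ hρ₂ hV

/-- Each `V x` is defined under its own measure `P x`. This expression through kernels allows `V` to
be recognized inside the tail of another series, in place of a shift of the path space. -/
theorem value_eq_integral (x : E) :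
    V x = ∫ z, stageReward (G.f i) (G.g i) (G.h i) p q z
        ∂(Kernel.sum (kernelIter (weighted κ fun y => α * ((1 - p y) * (1 - q y)))) x) := by
  rw [hV, M.J_eq_sum_add hα₀ hα₁ hf hg hh hG (fun _ => hp) (fun _ => hp_mem) (fun _ => hq)
    (fun _ => hq_mem) hρ₁ hρ₂ x 0 (fun _ _ => rfl) (fun _ _ => rfl), discountedLaw_zero]
  have hmeas := ((measurable_stageReward hf hg hh hp hq).stronglyMeasurable.integral_kernel
    (κ := Kernel.sum (kernelIter (weighted κ fun y => α * ((1 - p y) * (1 - q y))))))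
  rw [integral_dirac' _ _ hmeas]
  simp

include hp₀ hp₀_mem hq₀ hq₀_mem

theorem J_firstThen (hτ₁ : τ i = M.seqTime i (firstThen p₀ p))
    (hτ₂ : τ (1 - i) = M.seqTime (1 - i) (firstThen q₀ q)) (x : E) :
    M.J G i x τ = stageReward (G.f i) (G.g i) (G.h i) p₀ q₀ x +
      (1 - p₀ x) * (1 - q₀ x) * (α * ∫ y, V y ∂(κ x)) := by
  have hpm := measurable_firstThen hp₀ hp
  have hqm := measurable_firstThen hq₀ hq
  have hpI := firstThen_mem_Icc hp₀_mem hp_mem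
  have hqI := firstThen_mem_Icc hq₀_mem hq_mem
  rw [M.J_eq_sum_add hα₀ hα₁ hf hg hh hG hpm hpI hqm hqI hτ₁ hτ₂ x 1 (firstThen_of_one_le p₀ p)
      (firstThen_of_one_le q₀ q),
    Finset.sum_range_one, discountedLaw_zero, integral_dirac' _ _
      (measurable_stageReward hf hg hh (hpm 0) (hqm 0)).stronglyMeasurable,
    M.discountedLaw_one hα₀ (one_sub_ne i) hp₀ hp₀_mem hq₀ hq₀_mem hp hp_mem hq hq_mem]
  simp_rw [← M.value_eq_integral hα₀ hα₁ hf hg hh hG hp hp_mem hq hq_mem hρ₁ hρ₂ hV]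
  rw [integral_smul_measure, ENNReal.toReal_ofReal, smul_eq_mul]
  · simp only [firstThen]
    ring
  · exact mul_nonneg hα₀.le (mul_nonneg (sub_nonneg.2 (hp₀_mem x).2) (sub_nonneg.2 (hq₀_mem x).2))

omit hp₀ hp₀_mem hq₀ hq₀_mem in
theorem integrable_value (x : E) : Integrable V (κ x) := by
  have h0 : ∀ y : E, (fun _ : E => (0 : ℝ)) y ∈ Icc (0 : ℝ) 1 := fun _ => ⟨le_rfl, zero_le_one⟩
  have hz : Measurable fun _ : E => (0 : ℝ) := measurable_const
  have hpm := measurable_firstThen hz hp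
  have hqm := measurable_firstThen hz hq
  have hpI := firstThen_mem_Icc h0 hp_mem
  have hqI := firstThen_mem_Icc h0 hq_mem
  let τ : Fin 2 → Ω → ℕ∞ := fun k => if k = i then M.seqTime i (firstThen (fun _ => 0) p) else
      M.seqTime (1 - i) (firstThen (fun _ => 0) q)
  have h := (M.integrable_stageReward_sum (τ := τ) hα₀ hα₁ hf hg hh hG hpm hpI hqm hqI (if_pos rfl)
    (if_neg (one_sub_ne i).symm) x 1 (firstThen_of_one_le _ p)
    (firstThen_of_one_le _ q)).integral_bind_kernel
  simp_rw [← M.value_eq_integral hα₀ hα₁ hf hg hh hG hp hp_mem hq hq_mem hρ₁ hρ₂ hV] at h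
  rw [M.discountedLaw_one hα₀ (one_sub_ne i) hz h0 hz h0 hp hp_mem hq hq_mem, sub_zero, mul_one,
    mul_one, integrable_smul_measure (ENNReal.ofReal_pos.2 hα₀).ne' ENNReal.ofReal_ne_top] at h
  exact h

end FirstStep

end Model

end MarkovDynkin

/-! ### Equilibrium inequalities, zero-sum symmetry and the theorem -/

namespace MarkovDynkin

variable {E Ω : Type*} [MeasurableSpace E] [MeasurableSpace Ω] {κ : Kernel E E} {α : ℝ}

namespace Model

variable (M : Model κ α Ω)

/-- By definition, `markovTime` is `seqTime` of a constant sequence. -/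
theorem markovPair_mem_admissible {p : Fin 2 → E → ℝ} (hp : ∀ i, Measurable (p i)) (i : Fin 2) :
    M.markovPair p i ∈ M.admissible i :=
  M.seqTime_mem_admissible i fun _ => hp i

/-- In an equilibrium, the value function of each player dominates both the payoff of an immediate
stop and that of one round of waiting, and it is the corresponding mixture of the two. -/
theorem equilibrium_inequalities [IsMarkovKernel κ] (hα₀ : 0 < α) (hα₁ : α < 1) {G : Payoffs E}
    {i : Fin 2} (hf : Measurable (G.f i)) (hg : Measurable (G.g i)) (hh : Measurable (G.h i))
    (hG : M.PayoffsIntegrable G) {p : Fin 2 → E → ℝ} (hp : ∀ i, Measurable (p i))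
    (hp_mem : ∀ i y, p i y ∈ Icc (0 : ℝ) 1) {V : E → ℝ}
    (hV : ∀ x, V x = M.J G i x (M.markovPair p)) (heq : M.IsGlobalEquilibrium G p) (x : E) :
    (1 - p (1 - i) x) * G.f i x + p (1 - i) x * G.h i x ≤ V x ∧
      (1 - p (1 - i) x) * (α * ∫ y, V y ∂(κ x)) + p (1 - i) x * G.g i x ≤ V x ∧
      V x = p i x * ((1 - p (1 - i) x) * G.f i x + p (1 - i) x * G.h i x) +
        (1 - p i x) * ((1 - p (1 - i) x) * (α * ∫ y, V y ∂(κ x)) + p (1 - i) x * G.g i x) := by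
  have key : ∀ p₀ : E → ℝ, Measurable p₀ → (∀ y, p₀ y ∈ Icc (0 : ℝ) 1) →
      M.J G i x (Function.update (M.markovPair p) i (M.seqTime i (firstThen p₀ (p i)))) =
        stageReward (G.f i) (G.g i) (G.h i) p₀ (p (1 - i)) x +
          (1 - p₀ x) * (1 - p (1 - i) x) * (α * ∫ y, V y ∂(κ x)) := fun p₀ hp₀ hp₀_mem =>
    M.J_firstThen hα₀ hα₁ hf hg hh hG hp₀ hp₀_mem (hp (1 - i)) (hp_mem (1 - i)) (hp i) (hp_mem i)
      (hp (1 - i)) (hp_mem (1 - i)) rfl rfl hV (Function.update_self ..)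
      (by rw [Function.update_of_ne (one_sub_ne i).symm, firstThen_self]; rfl) x
  have hdev : ∀ p₀ : E → ℝ, Measurable p₀ → (∀ y, p₀ y ∈ Icc (0 : ℝ) 1) →
      stageReward (G.f i) (G.g i) (G.h i) p₀ (p (1 - i)) x +
          (1 - p₀ x) * (1 - p (1 - i) x) * (α * ∫ y, V y ∂(κ x)) ≤ V x := fun p₀ hp₀ hp₀_mem => by
    rw [← key p₀ hp₀ hp₀_mem, hV]
    exact ((heq x).2 i).1 ⟨_, M.seqTime_mem_admissible i (measurable_firstThen hp₀ (hp i)), rfl⟩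
  have h1 := hdev (fun _ => 1) measurable_const fun _ => ⟨zero_le_one, le_rfl⟩
  have h2 := hdev (fun _ => 0) measurable_const fun _ => ⟨le_rfl, zero_le_one⟩
  have h3 := key (p i) (hp i) (hp_mem i)
  have hself : Function.update (M.markovPair p) i (M.seqTime i fun _ => p i) = M.markovPair p :=
    Function.update_eq_self i _
  rw [firstThen_self, hself, ← hV] at h3
  simp only [stageReward] at h1 h2 h3
  exact ⟨by linarith, by linarith, by linarith⟩

theorem reward_zeroSum (f g h : E → ℝ) (τ : Fin 2 → Ω → ℕ∞) (ω : Ω) :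
    M.reward (Payoffs.zeroSum f g h) 1 τ ω = -M.reward (Payoffs.zeroSum f g h) 0 τ ω := by
  rcases lt_trichotomy (τ 0 ω) (τ 1 ω) with h1 | h1 | h1
  · simp [reward, Payoffs.zeroSum, h1, h1.not_gt]
  · by_cases h2 : τ 1 ω < ⊤ <;> simp [reward, Payoffs.zeroSum, h1, h2]
  · simp [reward, Payoffs.zeroSum, h1, h1.not_gt]

theorem J_zeroSum (f g h : E → ℝ) (x : E) (τ : Fin 2 → Ω → ℕ∞) :
    M.J (Payoffs.zeroSum f g h) 1 x τ = -M.J (Payoffs.zeroSum f g h) 0 x τ := by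
  simp only [J, M.reward_zeroSum, integral_neg]

theorem SupIntegrable.neg {u : E → ℝ} (h : M.SupIntegrable u) : M.SupIntegrable (-u) := by
  intro x
  convert h x using 5 with ω n
  cases M.killed n ω <;> simp

/-- Verification for one player: his Markovian strategy is a best response to that of the other
player, and it attains `V`. -/
theorem isLUB_of_optimality [IsMarkovKernel κ] (hα₀ : 0 < α) (hα₁ : α < 1) {G : Payoffs E}
    {i : Fin 2} (hf : Measurable (G.f i)) (hg : Measurable (G.g i)) (hh : Measurable (G.h i))
    (hG : M.PayoffsIntegrable G) {p : Fin 2 → E → ℝ} (hp : ∀ i, Measurable (p i))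
    (hp_mem : ∀ i y, p i y ∈ Icc (0 : ℝ) 1) {V : E → ℝ} (hV : Measurable V)
    (hVint : M.SupIntegrable V)
    (hhalt_le : ∀ y, (1 - p (1 - i) y) * G.f i y + p (1 - i) y * G.h i y ≤ V y)
    (hcont_le : ∀ y, (1 - p (1 - i) y) * (α * ∫ z, V z ∂(κ y)) + p (1 - i) y * G.g i y ≤ V y)
    (hhalt : ∀ y, 0 < p i y → (1 - p (1 - i) y) * G.f i y + p (1 - i) y * G.h i y = V y)
    (hcont : ∀ y, p i y < 1 →
      (1 - p (1 - i) y) * (α * ∫ z, V z ∂(κ y)) + p (1 - i) y * G.g i y = V y) (x : E) :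
    M.J G i x (M.markovPair p) = V x ∧
      IsLUB ((fun σ => M.J G i x (Function.update (M.markovPair p) i σ)) '' M.admissible i)
        (M.J G i x (M.markovPair p)) := by
  have hval : M.J G i x (M.markovPair p) = V x :=
    M.J_eq hα₀ hα₁ hf hg hh hG (M.markovPair_mem_admissible hp i) (hp (1 - i)) (hp_mem (1 - i)) rfl
      hV hVint (hp i) (hp_mem i) rfl x hhalt hcont
  refine ⟨hval, ?_, fun b hb => hb ⟨_, M.markovPair_mem_admissible hp i, ?_⟩⟩
  · rintro _ ⟨σ, hσ, rfl⟩
    rw [hval]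
    refine M.J_le hα₀ hα₁ hf hg hh hG ?_ (hp (1 - i)) (hp_mem (1 - i)) ?_ hV hVint x hhalt_le
      hcont_le
    · rwa [Function.update_self]
    · rw [Function.update_of_ne (one_sub_ne i).symm]
      rfl
  · simp only [Function.update_eq_self]

end Model

end MarkovDynkin

theorem mainTheorem11 {E Ω : Type*} [MeasurableSpace E] [MeasurableSpace Ω]
    (κ : Kernel E E) [IsMarkovKernel κ] (α : ℝ) (hα₀ : 0 < α) (hα₁ : α < 1)
    (M : MarkovDynkin.Model κ α Ω)
    (f g h : E → ℝ) (hf : Measurable f) (hg : Measurable g) (hh : Measurable h)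
    (hint : M.PayoffsIntegrable (MarkovDynkin.Payoffs.zeroSum f g h))
    (p₁ p₂ V : E → ℝ) (hp₁ : Measurable p₁) (hp₂ : Measurable p₂) (hV : Measurable V)
    (hp₁_mem : ∀ x, p₁ x ∈ Icc (0 : ℝ) 1) (hp₂_mem : ∀ x, p₂ x ∈ Icc (0 : ℝ) 1) :
    (M.IsGlobalEquilibrium (MarkovDynkin.Payoffs.zeroSum f g h) ![p₁, p₂] →
      M.HasValue f g h ![p₁, p₂] V →
        (∀ x, Integrable V (κ x)) ∧ MarkovDynkin.ZeroSumSystem κ α f g h p₁ p₂ V) ∧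
    (MarkovDynkin.ZeroSumSystem κ α f g h p₁ p₂ V → M.SupIntegrable V →
      M.IsGlobalEquilibrium (MarkovDynkin.Payoffs.zeroSum f g h) ![p₁, p₂] ∧
        M.HasValue f g h ![p₁, p₂] V) := by
  have hp : ∀ i, Measurable ((![p₁, p₂] : Fin 2 → E → ℝ) i) := by
    intro i; fin_cases i; exacts [hp₁, hp₂]
  have hp_mem : ∀ i y, (![p₁, p₂] : Fin 2 → E → ℝ) i y ∈ Icc (0 : ℝ) 1 := by
    intro i; fin_cases i; exacts [hp₁_mem, hp₂_mem]
  constructor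
  · intro heq hval
    have hval' : ∀ x, (-V) x = M.J (MarkovDynkin.Payoffs.zeroSum f g h) 1 x
        (M.markovPair ![p₁, p₂]) := fun x => by
      rw [M.J_zeroSum, ← hval x, Pi.neg_apply]
    refine ⟨M.integrable_value (i := 0) (G := MarkovDynkin.Payoffs.zeroSum f g h) hα₀ hα₁ hf hg hh
      hint hp₁ hp₁_mem hp₂ hp₂_mem rfl rfl hval, ?_⟩
    have h0 := M.equilibrium_inequalities (i := 0) hα₀ hα₁ hf hg hh hint hp hp_mem hval heq
    -- Player 2 maximizes with value `-V`; the payoffs for stopping first and second are `-g` and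
    -- `-f`, whence the exchanged order.
    have h1 := M.equilibrium_inequalities (i := 1) hα₀ hα₁ hg.neg hf.neg hh.neg hint hp hp_mem hval'
      heq
    simp only [MarkovDynkin.Payoffs.zeroSum, Matrix.cons_val_zero, Matrix.cons_val_one, sub_zero,
      sub_self, Pi.neg_apply, integral_neg] at h0 h1
    -- A convex combination of numbers at most `v` equals `v` only if every term of positive weight
    -- equals `v`.
    have mix : ∀ {p A B v : ℝ}, p ∈ Icc (0 : ℝ) 1 → B ≤ v → A ≤ v → v = p * B + (1 - p) * A →
        v = max A B ∧ (p > 0 → A ≤ B) ∧ (p < 1 → A ≥ B) := by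
      intro p A B v hp hB hA hv
      have hB' : p > 0 → B = v := fun hp0 => by
        refine le_antisymm hB (le_of_mul_le_mul_left ?_ hp0)
        nlinarith [mul_le_mul_of_nonneg_left hA (sub_nonneg.2 hp.2)]
      have hA' : p < 1 → A = v := fun hp1 => by
        refine le_antisymm hA (le_of_mul_le_mul_left ?_ (sub_pos.2 hp1))
        nlinarith [mul_le_mul_of_nonneg_left hB hp.1]
      refine ⟨le_antisymm ?_ (max_le hA hB), fun h => (hB' h).symm ▸ hA, fun h => (hA' h).symm ▸ hB⟩
      rcases hp.1.eq_or_lt with h | h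
      · exact le_max_of_le_left (hA' (h ▸ zero_lt_one)).ge
      · exact le_max_of_le_right (hB' h).ge
    have m0 := fun x => mix (hp₁_mem x) (h0 x).1 (h0 x).2.1 (h0 x).2.2
    have m1 := fun x => mix (hp₂_mem x) (h1 x).1 (h1 x).2.1 (h1 x).2.2
    refine ⟨fun x => (m0 x).1, fun x => ?_, fun x => (m0 x).2.1, fun x => (m0 x).2.2,
      fun x hx => ?_, fun x hx => ?_⟩
    · rw [← neg_inj, ← max_neg_neg, (m1 x).1]
      congr 1 <;> ring
    · linarith [(m1 x).2.1 hx]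
    · linarith [(m1 x).2.2 hx]
  · intro hsys hVint
    have h0 := M.isLUB_of_optimality (i := 0) (G := MarkovDynkin.Payoffs.zeroSum f g h)
      (p := ![p₁, p₂]) (V := V) hα₀ hα₁ hf hg hh hint hp hp_mem hV hVint
      (fun y => (le_max_right _ _).trans (hsys.value_max y).ge)
      (fun y => (le_max_left _ _).trans (hsys.value_max y).ge)
      (fun y hy => ((hsys.value_max y).trans (max_eq_right (hsys.max_stop y hy))).symm)
      (fun y hy => ((hsys.value_max y).trans (max_eq_left (hsys.max_cont y hy))).symm)
    have hneg : ∀ y, ∫ z, (-V) z ∂(κ y) = -∫ z, V z ∂(κ y) := fun y => integral_neg V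
    have h1 := M.isLUB_of_optimality (i := 1) (G := MarkovDynkin.Payoffs.zeroSum f g h)
      (p := ![p₁, p₂]) (V := -V) hα₀ hα₁ hg.neg hf.neg hh.neg hint hp hp_mem hV.neg
      (MarkovDynkin.Model.SupIntegrable.neg M hVint)
      (fun y => by
        have := (hsys.value_min y).le.trans (min_le_right _ _)
        simp [MarkovDynkin.Payoffs.zeroSum]
        linarith)
      (fun y => by
        have := (hsys.value_min y).le.trans (min_le_left _ _)
        rw [hneg]
        simp [MarkovDynkin.Payoffs.zeroSum]
        linarith)
      (fun y hy => by
        have := (hsys.value_min y).trans (min_eq_right (hsys.min_stop y hy))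
        simp [MarkovDynkin.Payoffs.zeroSum]
        linarith)
      (fun y hy => by
        have := (hsys.value_min y).trans (min_eq_left (hsys.min_cont y hy))
        rw [hneg]
        simp [MarkovDynkin.Payoffs.zeroSum]
        linarith)
    refine ⟨fun x => ⟨M.markovPair_mem_admissible hp, fun i => ?_⟩, fun x => (h0 x).1.symm⟩
    fin_cases i
    exacts [(h0 x).2, (h1 x).2]
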